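/- **Setting.** Let $\mu\in\mathbb R^d$ be a fixed signal vector. A training sample $i\in[n]$ has a true label $y_i\in\{\pm1\}$, an observed label $\tilde y_i\in\{\pm1\}$, and an input $x_i$ consisting of the two patches $y_i\mu$ and $\xi_i$, where $\xi_i\sim\mathcal N(0,\sigma_\xi^2 I_d)$. The labels are either (a) fixed and balanced: for $y=\pm1$, writing $\tau_{1}=\tau_+$, $\tau_{-1}=\tau_-$, exactly $(1-\tau_{y})n/2$ samples have $y_i=y=\tilde y_i$ and exactly $\tau_{y}n/2$ have $y_i=y\ne\tilde y_i$; or (b) random: the pairs $(y_i,\tilde y_i)$ are i.i.d. with $\mathbb P(y_i=\pm1)=\tfrac12$, $\mathbb P(\tilde y_i=-1\mid y_i=1)=\tau_+$, $\mathbb P(\tilde y_i=1\mid y_i=-1)=\tau_-$. The network is $f(W,x)=F_{+1}(W,x)-F_{-1}(W,x)$ with $F_j(W,x_i)=\frac1m\sum_{r=1}^m\big(\sigma(\langle w_{j,r},y_i\mu\rangle)+\sigma(\langle w_{j,r},\xi_i\rangle)\big)$ and $\sigma(z)=\max\{0,z\}$. It is initialized with $w^{(0)}_{j,r}\sim\mathcal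 N(0,\sigma_0^2I_d)$ ($j=\pm1$, $r\in[m]$); the labels, noise patches and initial weights are all independent. It is trained by gradient descent with step size $\eta$ on the logistic loss, $$w_{j,r}^{(t+1)}=w_{j,r}^{(t)}-\frac{\eta}{nm}\sum_{i=1}^n\ell_i'^{(t)}\sigma'(\langle w_{j,r}^{(t)},\xi_i\rangle)\,j\tilde y_i\,\xi_i-\frac{\eta}{nm}\sum_{i=1}^n\ell_i'^{(t)}\sigma'(\langle w_{j,r}^{(t)},y_i\mu\rangle)\,jy_i\tilde y_i\,\mu,$$ where $\ell_i'^{(t)}=-1/(1+\exp(\tilde y_if(W^{(t)},x_i)))$ and $\sigma'(z)=\mathbb 1(z\ge0)$. The signal coefficients $\gamma_{j,r}^{(t)}$ and noise coefficients $\rho_{j,r,i}^{(t)}$ are defined by $$w_{j,r}^{(t)}=w_{j,r}^{(0)}+j\gamma_{j,r}^{(t)}\|\mu\|_2^{-2}\mu+\sum_{i=1}^n\rho_{j,r,i}^{(t)}\|\xi_i\|_2^{-2}\xi_i ,$$ and $\overline\rho_{j,r,i}^{(t)}=\rho_{j,r,i}^{(t)}\mathbb 1(\rho_{j,r,i}^{(t)}\ge0)$.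 Let $\mathrm{SNR}=\|\mu\|_2/(\sigma_\xi\sqrt d)$. **Theorem.** Let $\kappa_{lo}\le\kappa_{hi}$ and $0<\tau_{lo}\le\tau_{hi}<\frac12$ be constants with $\kappa_{lo}(1-2\tau_{hi})>2$. There are constants $C,c,c'>0$, depending only on $\kappa_{lo},\kappa_{hi},\tau_{lo},\tau_{hi}$, such that the following holds whenever $n\ge2$, $\delta\in(0,1)$, $\sigma_\xi,\sigma_0,\eta>0$ and 1. $\kappa_{lo}\le n\cdot\mathrm{SNR}^2\le\kappa_{hi}$ and $\tau_+,\tau_-\in[\tau_{lo},\tau_{hi}]$; 2. $d\ge C\max\{n^2\log(nm/\delta),\ n\|\mu\|_2\sigma_\xi^{-1}\sqrt{\log(n/\delta)}\}$; 3. $m\ge C\log(n/\delta)$ and $n\ge C\log(m/\delta)$; 4. $\|\mu\|_2^2\ge C\sigma_\xi^2\log(n/\delta)$; 5. $\sigma_0\le C^{-1}\min\{\sqrt n\,\sigma_\xi^{-1}d^{-1},\ \|\mu\|_2^{-1}\log(m/\delta)^{-1/2}\}$; 6. $\eta\le C^{-1}\min\{\sigma_\xi^{-2}d^{-3/2}n^2m\sqrt{\log(n/\delta)},\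 \sigma_\xi^{-2}d^{-1}n\}$. There is an integer $T_1$ with $c\,\eta^{-1}nm\sigma_\xi^{-2}d^{-1}\le T_1\le c'\,\eta^{-1}nm\sigma_\xi^{-2}d^{-1}$ such that, in each of the label models (a) and (b), with probability at least $1-\delta$ the decomposition of $W^{(T_1)}$ exists and is unique and * $c\le\overline\rho_{\tilde y_i,r,i}^{(T_1)}\le c'$ for all $i\in[n]$, $r\in[m]$ with $\langle w_{\tilde y_i,r}^{(0)},\xi_i\rangle\ge0$; * $c\le\gamma_{j,r}^{(T_1)}\le c'$ for all $j=\pm1$, $r\in[m]$; * $\gamma_{j,r}^{(T_1)}>\overline\rho_{\tilde y_i,r',i}^{(T_1)}$ for all $j=\pm1$, $r,r'\in[m]$, $i\in[n]$; * $\tilde y_if(W^{(T_1)},x_i)\ge0$ for every clean sample ($\tilde y_i=y_i$); * $\tilde y_if(W^{(T_1)},x_i)\le0$ for every noisy sample ($\tilde y_i\ne y_i$). -/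

import Mathlib

namespace LabelNoiseCNN

open MeasureTheory ProbabilityTheory

/-- The patch space `ℝ^d` with its Euclidean norm. -/
abbrev Patch (d : ℕ) := EuclideanSpace ℝ (Fin d)

/-- Labels and output signs are the units `1` and `-1` of `ℤ`; this is their value in `ℝ`. -/
def sgn (j : ℤˣ) : ℝ := ((j : ℤ) : ℝ)

/-- First-layer weights `w_{j,r}`, `j = ±1`, `r ∈ [m]`. -/
abbrev Weights (m d : ℕ) := ℤˣ → Fin m → Patch d

/-- A training set of size `n` with signal vector `μ`: true labels `y_i`, observed labels `ỹ_i`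
and noise patches `ξ_i`. -/
structure TrainingSet (n d : ℕ) where
  signal : Patch d
  y : Fin n → ℤˣ
  yObs : Fin n → ℤˣ
  noise : Fin n → Patch d

/-- The two patches of the `i`-th input. Their order is immaterial, because the network below is
symmetric in the two patches. -/
def TrainingSet.input {n d : ℕ} (S : TrainingSet n d) (i : Fin n) : Patch d × Patch d :=
  (sgn (S.y i) • S.signal, S.noise i)

/-! ### The network and gradient descent -/

noncomputable def relu (x : ℝ) : ℝ := max 0 x

/-- The derivative of ReLU, with value `1` at the kink. -/
noncomputable def reluDeriv (x : ℝ) : ℝ := if 0 ≤ x then 1 else 0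

/-- `F_j(W_j, x)`. -/
noncomputable def branch {m d : ℕ} (W : Weights m d) (j : ℤˣ) (x : Patch d × Patch d) : ℝ :=
  (1 / (m : ℝ)) * ∑ r : Fin m, (relu (inner ℝ (W j r) x.1) + relu (inner ℝ (W j r) x.2))

/-- `f(W, x) = F_{+1}(W_{+1}, x) - F_{-1}(W_{-1}, x)`. -/
noncomputable def network {m d : ℕ} (W : Weights m d) (x : Patch d × Patch d) : ℝ :=
  branch W 1 x - branch W (-1) x

/-- The loss derivative `ℓ'_i = -1 / (1 + exp (ỹ_i f(W, x_i)))` of the logistic loss. -/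
noncomputable def lossDeriv {n m d : ℕ} (S : TrainingSet n d) (W : Weights m d) (i : Fin n) : ℝ :=
  -(1 / (1 + Real.exp (sgn (S.yObs i) * network W (S.input i))))

/-- One step of full-batch gradient descent on the empirical logistic risk, learning rate `η`. -/
noncomputable def gdStep {n m d : ℕ} (S : TrainingSet n d) (η : ℝ) (W : Weights m d) :
    Weights m d := fun j r =>
  W j r
    - (η / ((n : ℝ) * m)) • ∑ i : Fin n,
        (lossDeriv S W i * reluDeriv (inner ℝ (W j r) (S.noise i))
          * sgn j * sgn (S.yObs i)) • S.noise i
    - (η / ((n : ℝ) * m)) • ∑ i : Fin n,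
        (lossDeriv S W i * reluDeriv (inner ℝ (W j r) (sgn (S.y i) • S.signal))
          * sgn j * sgn (S.y i) * sgn (S.yObs i)) • S.signal

/-- The weights `W^{(t)}` started from `W₀`. -/
noncomputable def gdIter {n m d : ℕ} (S : TrainingSet n d) (η : ℝ) (W₀ : Weights m d) :
    ℕ → Weights m d
  | 0 => W₀
  | t + 1 => gdStep S η (gdIter S η W₀ t)

/-! ### Signal-noise decomposition -/

/-- Signal coefficients `γ_{j,r}` and noise coefficients `ρ_{j,r,i}`. -/
structure Coeffs (n m : ℕ) where
  γ : ℤˣ → Fin m → ℝ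
  ρ : ℤˣ → Fin m → Fin n → ℝ

/-- `ρ̄_{j,r,i} = ρ_{j,r,i} 𝟙(ρ_{j,r,i} ≥ 0)`. -/
noncomputable def Coeffs.ρpos {n m : ℕ} (c : Coeffs n m) (j : ℤˣ) (r : Fin m) (i : Fin n) : ℝ :=
  if 0 ≤ c.ρ j r i then c.ρ j r i else 0

/-- `c` are coefficients of `W` in the signal-noise decomposition
`w_{j,r} = w_{j,r}^{(0)} + j γ_{j,r} ‖μ‖⁻² μ + ∑ i, ρ_{j,r,i} ‖ξ_i‖⁻² ξ_i`. -/
def IsDecomposition {n m d : ℕ} (S : TrainingSet n d) (W₀ W : Weights m d) (c : Coeffs n m) :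
    Prop :=
  ∀ j r, W j r = W₀ j r + (sgn j * c.γ j r * (‖S.signal‖ ^ 2)⁻¹) • S.signal
    + ∑ i : Fin n, (c.ρ j r i * (‖S.noise i‖ ^ 2)⁻¹) • S.noise i

/-! ### Probability model -/

/-- `N(0, σ² I_d)`. -/
noncomputable def isoGaussian (d : ℕ) (σ : ℝ) : Measure (Patch d) :=
  (stdGaussian (Patch d)).map (fun x => σ • x)

/-- Joint law of the noise patches `ξ_i ~ N(0, σξ² I)` and of the initial weights
`w_{j,r} ~ N(0, σ0² I)`, all independent. -/
noncomputable def noiseInitLaw (n m d : ℕ) (σξ σ0 : ℝ) :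
    Measure ((Fin n → Patch d) × Weights m d) :=
  (Measure.pi fun _ : Fin n => isoGaussian d σξ).prod
    (Measure.pi fun _ : ℤˣ => Measure.pi fun _ : Fin m => isoGaussian d σ0)

/-- Probability that the observed label differs from the true label `y`. -/
noncomputable def flipProb (τp τm : ℝ) (y : ℤˣ) : ℝ := if y = 1 then τp else τm

/-- Joint law of `(y, ỹ)`: `y` is uniform on `±1`, and `ỹ ≠ y` with conditional
probability `flipProb τp τm y`. -/
noncomputable def labelLaw (τp τm : ℝ) : Measure (ℤˣ × ℤˣ) :=
  ∑ y : ℤˣ, ∑ y' : ℤˣ,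
    ENNReal.ofReal (1 / 2 * (if y' = y then 1 - flipProb τp τm y else flipProb τp τm y)) •
      Measure.dirac (y, y')

/-- A balanced labelled sample: half of the true labels are `1`, half are `-1`, and within each
class the fraction of flipped labels equals the flip probability. -/
def BalancedLabels {n : ℕ} (τp τm : ℝ) (y yObs : Fin n → ℤˣ) : Prop :=
  ∀ a : ℤˣ,
    ((Finset.univ.filter fun i => y i = a ∧ yObs i = y i).card : ℝ)
        = (1 - flipProb τp τm a) * n / 2 ∧
    ((Finset.univ.filter fun i => y i = a ∧ yObs i ≠ y i).card : ℝ)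
        = flipProb τp τm a * n / 2

/-! ### The parameter regime and the end of the first stage -/

/-- Signal-to-noise ratio `‖μ‖ / (σξ √d)`. -/
noncomputable def snr {d : ℕ} (μ : Patch d) (σξ : ℝ) : ℝ := ‖μ‖ / (σξ * √(d : ℝ))

/-- The parameter regime, with large constant `C`; `κlo, κhi` and `τlo, τhi` are the constants
behind `n · SNR² = Θ(1)` and `τ₊, τ₋ = Θ(1)`. -/
structure Regime (C κlo κhi τlo τhi : ℝ) (n m d : ℕ) (μ : Patch d)
    (σξ σ0 η δ τp τm : ℝ) : Prop where
  two_le_n : 2 ≤ n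
  δ_pos : 0 < δ
  δ_lt_one : δ < 1
  σξ_pos : 0 < σξ
  σ0_pos : 0 < σ0
  η_pos : 0 < η
  snr_lower : κlo ≤ n * snr μ σξ ^ 2
  snr_upper : n * snr μ σξ ^ 2 ≤ κhi
  τp_mem : τp ∈ Set.Icc τlo τhi
  τm_mem : τm ∈ Set.Icc τlo τhi
  d_large : C * max ((n : ℝ) ^ 2 * Real.log (n * m / δ))
    (n * ‖μ‖ * σξ⁻¹ * √(Real.log (n / δ))) ≤ d
  m_large : C * Real.log (n / δ) ≤ m
  n_large : C * Real.log (m / δ) ≤ n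
  signal_large : C * σξ ^ 2 * Real.log (n / δ) ≤ ‖μ‖ ^ 2
  σ0_small : σ0 ≤ C⁻¹ * min (√(n : ℝ) * σξ⁻¹ * (d : ℝ)⁻¹) (‖μ‖⁻¹ * (√(Real.log (m / δ)))⁻¹)
  η_small : η ≤ C⁻¹ * min
    ((σξ ^ 2)⁻¹ * ((d : ℝ) * √(d : ℝ))⁻¹ * (n : ℝ) ^ 2 * m * √(Real.log (n / δ)))
    ((σξ ^ 2)⁻¹ * (d : ℝ)⁻¹ * n)

/-- What is asserted about the weights `W^{(T)}`, with `lo, hi` the constants behind `Θ(1)`: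
the signal-noise decomposition exists and is unique, and its coefficients and the network outputs
on the training inputs are as claimed. -/
def StageOneOutcome {n m d : ℕ} (lo hi : ℝ) (S : TrainingSet n d) (η : ℝ) (W₀ : Weights m d)
    (T : ℕ) : Prop :=
  (∃! c : Coeffs n m, IsDecomposition S W₀ (gdIter S η W₀ T) c) ∧
  (∀ c : Coeffs n m, IsDecomposition S W₀ (gdIter S η W₀ T) c →
    (∀ i r, 0 ≤ inner ℝ (W₀ (S.yObs i) r) (S.noise i) →
      c.ρpos (S.yObs i) r i ∈ Set.Icc lo hi) ∧
    (∀ j r, c.γ j r ∈ Set.Icc lo hi) ∧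
    (∀ j r r' i, c.ρpos (S.yObs i) r' i < c.γ j r)) ∧
  (∀ i, S.yObs i = S.y i → 0 ≤ sgn (S.yObs i) * network (gdIter S η W₀ T) (S.input i)) ∧
  (∀ i, S.yObs i ≠ S.y i → sgn (S.yObs i) * network (gdIter S η W₀ T) (S.input i) ≤ 0)

end LabelNoiseCNN

namespace LabelNoiseCNN

open MeasureTheory ProbabilityTheory

/-! ### Elementary facts -/

/-! Training is stopped while the weights have moved only by a small constant, so that the dynamics
are still almost linear. Put `h = η / (n m)`, `v = σξ² d` and let `s = T h v` be the rescaled time.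

Since every loss derivative lies in `[-1, 0]`, the noise coefficients are at most `2 s` and the
signal coefficients at most `s κhi`, without any bootstrap. The patches are nearly orthogonal to
each other and to the initial weights, so the inner product of a weight with a patch is the matching
coefficient up to `2 ε` (`FirstStage.abs_inner_noise_sub_le`, `FirstStage.abs_inner_signal_sub_le`).
The outputs are therefore small and each `-ℓ'` is `1/2` up to a small `θ`
(`FirstStage.abs_loss_le`).

This fixes the growth rates. On the branch `ỹ_i` a noise coefficient gains at most about `h v / 2`
per step (`FirstStage.ρ_le`), and about that much if the neuron starts active on `ξ_i`, because it
then stays active (`FirstStage.inner_noise_nonneg`, `FirstStage.le_ρ`). A neuron of either sign is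
active on the signal patches of at least one whole class, where clean labels outnumber flipped ones
by about `(1 - 2τ) n / 2`; so a signal coefficient gains at least about `h n ‖μ‖² (1 - 2τ) / 4 ≥ h v
κlo (1 - 2τhi) / 4` (`FirstStage.le_γ`). The hypothesis `κlo (1 - 2τhi) > 2` says that this exceeds
`h v / 2`. The signal wins by `s θ`, which dominates the orthogonality errors, so the network
follows the true label: it fits clean samples and contradicts flipped ones (`FirstStage.outcome`).

Near-orthogonality comes from Gaussian and chi-square tails (`noiseInitLaw_not_good_le`), the class
margin of random labels from Hoeffding's inequality (`labelLaw_not_margin_le`). -/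

lemma sgn_mul_self (j : ℤˣ) : sgn j * sgn j = 1 := by
  rcases Int.units_eq_one_or j with rfl | rfl <;> simp [sgn]

lemma abs_sgn (j : ℤˣ) : |sgn j| = 1 := by
  rcases Int.units_eq_one_or j with rfl | rfl <;> simp [sgn]

lemma sgn_neg (j : ℤˣ) : sgn (-j) = -sgn j := by simp [sgn]

lemma relu_nonneg (x : ℝ) : 0 ≤ relu x := le_max_left _ _

lemma le_relu (x : ℝ) : x ≤ relu x := le_max_right _ _

lemma relu_le {x b : ℝ} (hb : 0 ≤ b) (h : x ≤ b) : relu x ≤ b := max_le hb h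

lemma reluDeriv_nonneg (x : ℝ) : 0 ≤ reluDeriv x := by unfold reluDeriv; split_ifs <;> norm_num

lemma reluDeriv_le_one (x : ℝ) : reluDeriv x ≤ 1 := by unfold reluDeriv; split_ifs <;> norm_num

/-- The logistic function is close to `1 / 2` near the origin. -/
lemma abs_logistic_sub_half_le (x : ℝ) : |1 / (1 + Real.exp x) - 1 / 2| ≤ |x| := by
  have hx : 0 < 1 + Real.exp x := by positivity
  have key : 1 / (1 + Real.exp x) - 1 / 2 = (1 - Real.exp x) / (2 * (1 + Real.exp x)) := by
    field_simp; ring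
  have h1 : x + 1 ≤ Real.exp x := Real.add_one_le_exp x
  have h2 : -x + 1 ≤ Real.exp (-x) := Real.add_one_le_exp (-x)
  have h3 : Real.exp x * Real.exp (-x) = 1 := by rw [← Real.exp_add]; simp
  have h4 : Real.exp x * (-x + 1) ≤ 1 := by
    exact (mul_le_mul_of_nonneg_left h2 (Real.exp_pos x).le).trans_eq h3
  rw [key, abs_div, abs_of_pos (by positivity : (0 : ℝ) < 2 * (1 + Real.exp x)),
    div_le_iff₀ (by positivity)]
  have hE := Real.exp_pos x
  rcases le_total 0 x with h | h
  · rw [abs_of_nonneg h, abs_le]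
    constructor <;> nlinarith [mul_nonneg h hE.le]
  · rw [abs_of_nonpos h, abs_le]
    constructor <;> nlinarith [mul_nonneg (neg_nonneg.2 h) hE.le]

/-! ### The network near small weights -/

section Network

variable {n m d : ℕ}

lemma branch_nonneg (W : Weights m d) (j : ℤˣ) (x : Patch d × Patch d) : 0 ≤ branch W j x := by
  unfold branch
  exact mul_nonneg (by positivity)
    (Finset.sum_nonneg fun r _ => add_nonneg (relu_nonneg _) (relu_nonneg _))

lemma branch_le (hm : 0 < m) {W : Weights m d} {j : ℤˣ} {x : Patch d × Patch d} {b : ℝ}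
    (h : ∀ r, relu (inner ℝ (W j r) x.1) + relu (inner ℝ (W j r) x.2) ≤ b) : branch W j x ≤ b := by
  have hm' : (0 : ℝ) < m := by exact_mod_cast hm
  unfold branch
  rw [one_div, inv_mul_le_iff₀ hm']
  calc _ ≤ ∑ _r : Fin m, b := Finset.sum_le_sum fun r _ => h r
    _ = m * b := by simp

lemma le_branch (hm : 0 < m) {W : Weights m d} {j : ℤˣ} {x : Patch d × Patch d} {b : ℝ}
    (h : ∀ r, b ≤ relu (inner ℝ (W j r) x.1) + relu (inner ℝ (W j r) x.2)) : b ≤ branch W j x := by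
  have hm' : (0 : ℝ) < m := by exact_mod_cast hm
  unfold branch
  rw [one_div, le_inv_mul_iff₀ hm']
  calc (m : ℝ) * b = ∑ _r : Fin m, b := by simp
    _ ≤ _ := Finset.sum_le_sum fun r _ => h r

lemma sgn_mul_network (W : Weights m d) (j : ℤˣ) (x : Patch d × Patch d) :
    sgn j * network W x = branch W j x - branch W (-j) x := by
  rcases Int.units_eq_one_or j with rfl | rfl <;> simp [sgn, network]

lemma abs_network_le (hm : 0 < m) {W : Weights m d} {x : Patch d × Patch d} {b : ℝ}
    (h : ∀ j r, relu (inner ℝ (W j r) x.1) + relu (inner ℝ (W j r) x.2) ≤ b) :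
    |network W x| ≤ b := by
  have h1 := branch_nonneg W 1 x
  have h2 := branch_nonneg W (-1) x
  have h3 := branch_le hm (h 1)
  have h4 := branch_le hm (h (-1))
  rw [network, abs_le]; constructor <;> linarith

lemma abs_lossDeriv_add_half_le (S : TrainingSet n d) (W : Weights m d) (i : Fin n) :
    |-lossDeriv S W i - 1 / 2| ≤ |network W (S.input i)| := by
  have := abs_logistic_sub_half_le (sgn (S.yObs i) * network W (S.input i))
  rw [abs_mul, abs_sgn, one_mul] at this
  simpa [lossDeriv] using this

lemma neg_lossDeriv_nonneg (S : TrainingSet n d) (W : Weights m d) (i : Fin n) :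
    0 ≤ -lossDeriv S W i := by
  rw [lossDeriv, neg_neg]; positivity

lemma neg_lossDeriv_le_one (S : TrainingSet n d) (W : Weights m d) (i : Fin n) :
    -lossDeriv S W i ≤ 1 := by
  rw [lossDeriv, neg_neg, div_le_one (by positivity)]
  linarith [Real.exp_pos (sgn (S.yObs i) * network W (S.input i))]

end Network

/-! ### Nearly orthogonal patches -/

/-- The noise patches have squared norm about `v`, and are nearly orthogonal to each other and to
the signal. -/
structure NearlyOrthogonal {n d : ℕ} (ε v : ℝ) (μ : Patch d) (ξ : Fin n → Patch d) : Prop where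
  norm_sq : ∀ i, |‖ξ i‖ ^ 2 - v| ≤ ε * v
  noise : ∀ i k, i ≠ k → n * |inner ℝ (ξ i) (ξ k)| ≤ ε * v
  signal : ∀ i, n * |inner ℝ (ξ i) μ| ≤ ε * v
  signal' : ∀ i, |inner ℝ (ξ i) μ| ≤ ε * ‖μ‖ ^ 2

/-- The initial weights are nearly orthogonal to the patches. -/
structure SmallInit {n m d : ℕ} (ε : ℝ) (μ : Patch d) (ξ : Fin n → Patch d) (W : Weights m d) :
    Prop where
  noise : ∀ j r i, |inner ℝ (W j r) (ξ i)| ≤ ε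
  signal : ∀ j r, |inner ℝ (W j r) μ| ≤ ε

/-- In each class the clean labels outnumber the flipped ones by at least `b * n`. -/
def LabelMargin {n : ℕ} (b : ℝ) (y yObs : Fin n → ℤˣ) : Prop :=
  ∀ a : ℤˣ, b * n ≤ ∑ i with y i = a, sgn (y i) * sgn (yObs i)

section NearlyOrthogonal

variable {n d : ℕ} {ε v : ℝ} {μ : Patch d} {ξ : Fin n → Patch d}

/-- The combination of patches with coefficients `g` and `ρ` relative to the normalized patches. -/
noncomputable def patchComb (μ : Patch d) (ξ : Fin n → Patch d) (g : ℝ) (ρ : Fin n → ℝ) : Patch d :=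
  (g * (‖μ‖ ^ 2)⁻¹) • μ + ∑ i, (ρ i * (‖ξ i‖ ^ 2)⁻¹) • ξ i

lemma NearlyOrthogonal.half_le (h : NearlyOrthogonal ε v μ ξ) (hε : ε ≤ 1 / 2) (hv : 0 < v)
    (i : Fin n) : v / 2 ≤ ‖ξ i‖ ^ 2 := by
  have := (abs_le.1 (h.norm_sq i)).1
  nlinarith

/-- Each term is at most `B * (2 / v) * (ε * v / n)` and there are at most `n` of them. The factor
`n` in the orthogonality hypotheses is there to pay for this sum. -/
lemma NearlyOrthogonal.abs_sum_le (h : NearlyOrthogonal ε v μ ξ) (hn : 0 < n) (hε : ε ≤ 1 / 2)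
    (hv : 0 < v) {B : ℝ} {ρ : Fin n → ℝ} (hρ : ∀ i, |ρ i| ≤ B) (s : Finset (Fin n))
    (f : Fin n → ℝ) (hf : ∀ i ∈ s, n * |f i| ≤ ε * v) (hε0 : 0 ≤ ε) :
    |∑ i ∈ s, ρ i * (‖ξ i‖ ^ 2)⁻¹ * f i| ≤ 2 * ε * B := by
  have hn' : (0 : ℝ) < n := by exact_mod_cast hn
  have hB : 0 ≤ B := (abs_nonneg _).trans (hρ ⟨0, hn⟩)
  have term : ∀ i ∈ s, |ρ i * (‖ξ i‖ ^ 2)⁻¹ * f i| ≤ 2 * ε * B / n := by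
    intro i hi
    have hq := h.half_le hε hv i
    have hq0 : 0 < ‖ξ i‖ ^ 2 := by linarith
    have hfi : |f i| ≤ ε * v / n := by rw [le_div_iff₀ hn', mul_comm]; exact hf i hi
    have hinv : (‖ξ i‖ ^ 2)⁻¹ ≤ 2 / v := by
      rw [inv_le_comm₀ hq0 (by positivity), inv_div]; exact hq
    rw [abs_mul, abs_mul, abs_of_pos (inv_pos.2 hq0)]
    calc |ρ i| * (‖ξ i‖ ^ 2)⁻¹ * |f i| ≤ B * (2 / v) * (ε * v / n) := by
          gcongr
          exact hρ i
      _ = 2 * ε * B / n := by field_simp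
  calc |∑ i ∈ s, ρ i * (‖ξ i‖ ^ 2)⁻¹ * f i| ≤ ∑ i ∈ s, |ρ i * (‖ξ i‖ ^ 2)⁻¹ * f i| :=
        Finset.abs_sum_le_sum_abs _ _
    _ ≤ ∑ _i ∈ s, 2 * ε * B / n := Finset.sum_le_sum term
    _ = s.card * (2 * ε * B / n) := by simp
    _ ≤ n * (2 * ε * B / n) := by
        gcongr
        simpa using Finset.card_le_univ s
    _ = 2 * ε * B := by field_simp

/-- The diagonal term reproduces `ρ i` exactly. The signal term costs `ε * A` by `signal'`, the
off-diagonal noise terms `2 * ε * B`. -/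
lemma NearlyOrthogonal.abs_inner_noise_sub_le (h : NearlyOrthogonal ε v μ ξ) (hn : 0 < n)
    (hε0 : 0 ≤ ε) (hε : ε ≤ 1 / 2) (hv : 0 < v) (hμ : 0 < ‖μ‖ ^ 2) {A B g : ℝ} {ρ : Fin n → ℝ}
    (hg : |g| ≤ A) (hρ : ∀ i, |ρ i| ≤ B) (i : Fin n) :
    |inner ℝ (patchComb μ ξ g ρ) (ξ i) - ρ i| ≤ ε * (A + 2 * B) := by
  have hq := h.half_le hε hv i
  have hq0 : ‖ξ i‖ ^ 2 ≠ 0 := by linarith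
  have hA : 0 ≤ A := (abs_nonneg _).trans hg
  have e : inner ℝ (patchComb μ ξ g ρ) (ξ i) - ρ i
      = g * (‖μ‖ ^ 2)⁻¹ * inner ℝ μ (ξ i)
        + ∑ k ∈ Finset.univ.erase i, ρ k * (‖ξ k‖ ^ 2)⁻¹ * inner ℝ (ξ k) (ξ i) := by
    simp only [patchComb, inner_add_left, sum_inner, inner_smul_left, RCLike.conj_to_real]
    rw [← Finset.add_sum_erase _ _ (Finset.mem_univ i), real_inner_self_eq_norm_sq,
      inv_mul_cancel_right₀ hq0]
    ring
  have h1 : |g * (‖μ‖ ^ 2)⁻¹ * inner ℝ μ (ξ i)| ≤ ε * A := by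
    rw [abs_mul, abs_mul, abs_of_pos (inv_pos.2 hμ), real_inner_comm]
    calc |g| * (‖μ‖ ^ 2)⁻¹ * |inner ℝ (ξ i) μ| ≤ A * (‖μ‖ ^ 2)⁻¹ * (ε * ‖μ‖ ^ 2) := by
          gcongr
          exact h.signal' i
      _ = ε * A := by linear_combination A * ε * mul_inv_cancel₀ hμ.ne'
  have h2 := h.abs_sum_le hn hε hv hρ (Finset.univ.erase i) (fun k => inner ℝ (ξ k) (ξ i))
    (fun k hk => h.noise k i (Finset.ne_of_mem_erase hk)) hε0
  rw [e]
  refine (abs_add_le _ _).trans ?_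
  linarith

lemma NearlyOrthogonal.abs_inner_signal_sub_le (h : NearlyOrthogonal ε v μ ξ) (hn : 0 < n)
    (hε0 : 0 ≤ ε) (hε : ε ≤ 1 / 2) (hv : 0 < v) (hμ : 0 < ‖μ‖ ^ 2) {B g : ℝ} {ρ : Fin n → ℝ}
    (hρ : ∀ i, |ρ i| ≤ B) :
    |inner ℝ (patchComb μ ξ g ρ) μ - g| ≤ ε * (2 * B) := by
  have e : inner ℝ (patchComb μ ξ g ρ) μ - g
      = ∑ k, ρ k * (‖ξ k‖ ^ 2)⁻¹ * inner ℝ (ξ k) μ := by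
    simp only [patchComb, inner_add_left, sum_inner, inner_smul_left, RCLike.conj_to_real]
    rw [real_inner_self_eq_norm_sq, inv_mul_cancel_right₀ hμ.ne']
    ring
  have h2 := h.abs_sum_le hn hε hv hρ Finset.univ (fun k => inner ℝ (ξ k) μ)
    (fun k _ => h.signal k) hε0
  rw [e]
  linarith

/-- Nearly orthogonal patches are linearly independent. -/
lemma NearlyOrthogonal.eq_zero_of_patchComb_eq_zero (h : NearlyOrthogonal ε v μ ξ) (hn : 0 < n)
    (hε0 : 0 ≤ ε) (hε : ε ≤ 1 / 4) (hv : 0 < v) (hμ : 0 < ‖μ‖ ^ 2) {g : ℝ} {ρ : Fin n → ℝ}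
    (h0 : patchComb μ ξ g ρ = 0) : g = 0 ∧ ρ = 0 := by
  have hg : |g| ≤ max |g| ‖ρ‖ := le_max_left _ _
  have hρ : ∀ i, |ρ i| ≤ max |g| ‖ρ‖ := fun i => (norm_le_pi_norm ρ i).trans (le_max_right _ _)
  have hX : 0 ≤ max |g| ‖ρ‖ := (abs_nonneg g).trans hg
  have h1 := h.abs_inner_signal_sub_le (g := g) hn hε0 (by linarith) hv hμ hρ
  have h2 := h.abs_inner_noise_sub_le hn hε0 (by linarith) hv hμ hg hρ
  rw [h0] at h1
  simp only [h0, inner_zero_left, zero_sub, abs_neg] at h1 h2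
  -- With `M = max |g| ‖ρ‖`, the two estimates give `|g| ≤ 2 * ε * M` and `|ρ i| ≤ 3 * ε * M`; `ε ≤
  -- 1 / 4` makes this a contraction.
  have key : max |g| ‖ρ‖ ≤ 3 / 4 * max |g| ‖ρ‖ := by
    refine max_le (h1.trans (by nlinarith)) ?_
    rw [pi_norm_le_iff_of_nonneg (by positivity)]
    exact fun i => (h2 i).trans (by nlinarith)
  have hz : max |g| ‖ρ‖ = 0 := by linarith
  exact ⟨abs_eq_zero.1 (le_antisymm (hg.trans hz.le) (abs_nonneg _)),
    norm_eq_zero.1 (le_antisymm ((le_max_right _ _).trans hz.le) (norm_nonneg _))⟩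

end NearlyOrthogonal

/-! ### The coefficients along gradient descent -/

section Coeffs

variable {n m d : ℕ} {ε v : ℝ} {S : TrainingSet n d} {η : ℝ} {W₀ : Weights m d}

lemma isDecomposition_iff {W : Weights m d} {c : Coeffs n m} :
    IsDecomposition S W₀ W c ↔
      ∀ j r, W j r = W₀ j r + patchComb S.signal S.noise (sgn j * c.γ j r) (c.ρ j r) := by
  simp only [IsDecomposition, patchComb, add_assoc]

lemma NearlyOrthogonal.decomposition_unique (h : NearlyOrthogonal ε v S.signal S.noise)
    (hn : 0 < n) (hε0 : 0 ≤ ε) (hε : ε ≤ 1 / 4) (hv : 0 < v) (hμ : 0 < ‖S.signal‖ ^ 2)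
    {W : Weights m d} {c c' : Coeffs n m} (hc : IsDecomposition S W₀ W c)
    (hc' : IsDecomposition S W₀ W c') : c = c' := by
  have key : ∀ j r, sgn j * c.γ j r - sgn j * c'.γ j r = 0 ∧ c.ρ j r - c'.ρ j r = 0 := by
    intro j r
    refine h.eq_zero_of_patchComb_eq_zero hn hε0 hε hv hμ ?_
    have e := (isDecomposition_iff.1 hc j r).symm.trans (isDecomposition_iff.1 hc' j r)
    have e' := sub_eq_zero.2 (add_left_cancel e)
    rw [← e']
    simp only [patchComb, sub_mul, sub_smul, Finset.sum_sub_distrib, Pi.sub_apply]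
    abel
  obtain ⟨γ, ρ⟩ := c
  obtain ⟨γ', ρ'⟩ := c'
  congr 1
  · funext j r
    have h1 := (key j r).1
    have h2 := sgn_mul_self j
    simp only at h1
    linear_combination sgn j * h1 - (γ j r - γ' j r) * h2
  · funext j r
    exact sub_eq_zero.1 (key j r).2

variable (S η W₀) in
/-- The signal and noise coefficients of the gradient descent iterates. -/
noncomputable def coeffIter : ℕ → Coeffs n m
  | 0 => ⟨fun _ _ => 0, fun _ _ _ => 0⟩
  | t + 1 =>
    { γ := fun j r => (coeffIter t).γ j r + η / (n * m) * (‖S.signal‖ ^ 2 *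
        ∑ i, -lossDeriv S (gdIter S η W₀ t) i
          * reluDeriv (inner ℝ (gdIter S η W₀ t j r) (sgn (S.y i) • S.signal))
          * (sgn (S.y i) * sgn (S.yObs i)))
      ρ := fun j r i => (coeffIter t).ρ j r i + η / (n * m) * (‖S.noise i‖ ^ 2 *
        (-lossDeriv S (gdIter S η W₀ t) i
          * reluDeriv (inner ℝ (gdIter S η W₀ t j r) (S.noise i))
          * (sgn j * sgn (S.yObs i)))) }

lemma isDecomposition_coeffIter (hμ : ‖S.signal‖ ^ 2 ≠ 0) (hξ : ∀ i, ‖S.noise i‖ ^ 2 ≠ 0)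
    (t : ℕ) : IsDecomposition S W₀ (gdIter S η W₀ t) (coeffIter S η W₀ t) := by
  induction t with
  | zero => intro j r; simp [gdIter, coeffIter]
  | succ t ih =>
    intro j r
    have ih' := ih j r
    simp only [gdIter, gdStep, coeffIter]
    set W := gdIter S η W₀ t
    set c := coeffIter S η W₀ t
    have e1 : (sgn j * (c.γ j r + η / (n * m) * (‖S.signal‖ ^ 2 *
        ∑ i, -lossDeriv S W i * reluDeriv (inner ℝ (W j r) (sgn (S.y i) • S.signal))
          * (sgn (S.y i) * sgn (S.yObs i)))) * (‖S.signal‖ ^ 2)⁻¹) • S.signal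
        = (sgn j * c.γ j r * (‖S.signal‖ ^ 2)⁻¹) • S.signal - (η / (n * m)) • ∑ i : Fin n,
        (lossDeriv S W i * reluDeriv (inner ℝ (W j r) (sgn (S.y i) • S.signal))
          * sgn j * sgn (S.y i) * sgn (S.yObs i)) • S.signal := by
      rw [← Finset.sum_smul, smul_smul, ← sub_smul]
      congr 1
      have : ∑ i : Fin n, (lossDeriv S W i * reluDeriv (inner ℝ (W j r) (sgn (S.y i) • S.signal))
          * sgn j * sgn (S.y i) * sgn (S.yObs i))
          = - (sgn j * ∑ i, -lossDeriv S W i * reluDeriv (inner ℝ (W j r) (sgn (S.y i) • S.signal))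
          * (sgn (S.y i) * sgn (S.yObs i))) := by
        rw [Finset.mul_sum, ← Finset.sum_neg_distrib]
        exact Finset.sum_congr rfl fun i _ => by ring
      rw [this]
      generalize (∑ i, -lossDeriv S W i * reluDeriv (inner ℝ (W j r) (sgn (S.y i) • S.signal))
          * (sgn (S.y i) * sgn (S.yObs i))) = X
      linear_combination sgn j * (η / (n * m)) * X * mul_inv_cancel₀ hμ
    have e2 : ∑ i, ((c.ρ j r i + η / (n * m) * (‖S.noise i‖ ^ 2 *
        (-lossDeriv S W i * reluDeriv (inner ℝ (W j r) (S.noise i))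
          * (sgn j * sgn (S.yObs i))))) * (‖S.noise i‖ ^ 2)⁻¹) • S.noise i
        = ∑ i, (c.ρ j r i * (‖S.noise i‖ ^ 2)⁻¹) • S.noise i - (η / (n * m)) • ∑ i : Fin n,
        (lossDeriv S W i * reluDeriv (inner ℝ (W j r) (S.noise i))
          * sgn j * sgn (S.yObs i)) • S.noise i := by
      rw [Finset.smul_sum, ← Finset.sum_sub_distrib]
      refine Finset.sum_congr rfl fun i _ => ?_
      rw [smul_smul, ← sub_smul]
      congr 1
      linear_combination η / (n * m) * (-lossDeriv S W i
        * reluDeriv (inner ℝ (W j r) (S.noise i)) * (sgn j * sgn (S.yObs i)))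
        * mul_inv_cancel₀ (hξ i)
    rw [e1, e2]
    -- Only the leading weight is expanded; the activation indicators must keep `W j r`.
    nth_rewrite 1 [ih']
    abel

end Coeffs

/-! ### The first stage of training -/

section FirstStage

variable {n m d : ℕ} {S : TrainingSet n d} {η : ℝ} {W₀ : Weights m d}

lemma step_nonneg (hη : 0 ≤ η) : 0 ≤ η / (n * m : ℝ) := by positivity

lemma coeffIter_ρ_succ (t : ℕ) (j : ℤˣ) (r : Fin m) (i : Fin n) :
    (coeffIter S η W₀ (t + 1)).ρ j r i = (coeffIter S η W₀ t).ρ j r i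
      + η / (n * m) * (‖S.noise i‖ ^ 2 * (-lossDeriv S (gdIter S η W₀ t) i
        * reluDeriv (inner ℝ (gdIter S η W₀ t j r) (S.noise i))
        * (sgn j * sgn (S.yObs i)))) := rfl

lemma coeffIter_γ_succ (t : ℕ) (j : ℤˣ) (r : Fin m) :
    (coeffIter S η W₀ (t + 1)).γ j r = (coeffIter S η W₀ t).γ j r
      + η / (n * m) * (‖S.signal‖ ^ 2 * ∑ i, -lossDeriv S (gdIter S η W₀ t) i
          * reluDeriv (inner ℝ (gdIter S η W₀ t j r) (sgn (S.y i) • S.signal))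
          * (sgn (S.y i) * sgn (S.yObs i))) := rfl

lemma loss_mul_reluDeriv_mem (W : Weights m d) (i : Fin n) (x : ℝ) :
    -lossDeriv S W i * reluDeriv x ∈ Set.Icc (0 : ℝ) 1 :=
  ⟨mul_nonneg (neg_lossDeriv_nonneg S W i) (reluDeriv_nonneg x),
    mul_le_one₀ (neg_lossDeriv_le_one S W i) (reluDeriv_nonneg x) (reluDeriv_le_one x)⟩

lemma abs_coeffIter_ρ_step_le (hη : 0 ≤ η) (t : ℕ) (j : ℤˣ) (r : Fin m) (i : Fin n) :
    |(coeffIter S η W₀ (t + 1)).ρ j r i - (coeffIter S η W₀ t).ρ j r i|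
      ≤ η / (n * m) * ‖S.noise i‖ ^ 2 := by
  rw [coeffIter_ρ_succ, add_sub_cancel_left, abs_mul, abs_of_nonneg (step_nonneg hη), abs_mul,
    abs_of_nonneg (sq_nonneg _), abs_mul, abs_mul (sgn _), abs_sgn, abs_sgn]
  have h := loss_mul_reluDeriv_mem (S := S) (gdIter S η W₀ t) i
    (inner ℝ (gdIter S η W₀ t j r) (S.noise i))
  rw [abs_of_nonneg h.1, mul_one, mul_one]
  exact mul_le_mul_of_nonneg_left (mul_le_of_le_one_right (sq_nonneg _) h.2) (step_nonneg hη)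

lemma abs_coeffIter_γ_step_le (hη : 0 ≤ η) (t : ℕ) (j : ℤˣ) (r : Fin m) :
    |(coeffIter S η W₀ (t + 1)).γ j r - (coeffIter S η W₀ t).γ j r|
      ≤ η / (n * m) * (n * ‖S.signal‖ ^ 2) := by
  rw [coeffIter_γ_succ, add_sub_cancel_left, abs_mul, abs_of_nonneg (step_nonneg hη), abs_mul,
    abs_of_nonneg (sq_nonneg _), mul_comm (n : ℝ) (‖S.signal‖ ^ 2)]
  refine mul_le_mul_of_nonneg_left (mul_le_mul_of_nonneg_left ?_ (sq_nonneg _)) (step_nonneg hη)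
  refine (Finset.abs_sum_le_sum_abs _ _).trans ?_
  calc _ ≤ ∑ _i : Fin n, (1 : ℝ) := Finset.sum_le_sum fun i _ => by
        have h := loss_mul_reluDeriv_mem (S := S) (gdIter S η W₀ t) i
          (inner ℝ (gdIter S η W₀ t j r) (sgn (S.y i) • S.signal))
        rw [abs_mul, abs_mul (sgn _), abs_sgn, abs_sgn, abs_of_nonneg h.1, mul_one, mul_one]
        exact h.2
    _ = n := by simp

lemma abs_le_of_abs_step_le {u : ℕ → ℝ} {b : ℝ} (h0 : u 0 = 0) (h : ∀ t, |u (t + 1) - u t| ≤ b)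
    (t : ℕ) : |u t| ≤ t * b := by
  induction t with
  | zero => simp [h0]
  | succ t ih =>
    have := abs_add_le (u (t + 1) - u t) (u t)
    rw [sub_add_cancel] at this
    push_cast
    linarith [h t]

lemma abs_coeffIter_ρ_le (hη : 0 ≤ η) (t : ℕ) (j : ℤˣ) (r : Fin m) (i : Fin n) :
    |(coeffIter S η W₀ t).ρ j r i| ≤ t * (η / (n * m) * ‖S.noise i‖ ^ 2) :=
  abs_le_of_abs_step_le (u := fun t => (coeffIter S η W₀ t).ρ j r i) rfl
    (fun t => abs_coeffIter_ρ_step_le hη t j r i) t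

lemma abs_coeffIter_γ_le (hη : 0 ≤ η) (t : ℕ) (j : ℤˣ) (r : Fin m) :
    |(coeffIter S η W₀ t).γ j r| ≤ t * (η / (n * m) * (n * ‖S.signal‖ ^ 2)) :=
  abs_le_of_abs_step_le (u := fun t => (coeffIter S η W₀ t).γ j r) rfl
    (fun t => abs_coeffIter_γ_step_le hη t j r) t

/-- Every increment of `ρ j r i` has the sign of `j * ỹ_i`. Hence the positive part `ρpos` is `ρ`
itself on the branch `ỹ_i`. -/
lemma coeffIter_ρ_nonneg (hη : 0 ≤ η) (t : ℕ) (r : Fin m) (i : Fin n) :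
    0 ≤ (coeffIter S η W₀ t).ρ (S.yObs i) r i := by
  induction t with
  | zero => exact le_rfl
  | succ t ih =>
    rw [coeffIter_ρ_succ, sgn_mul_self, mul_one]
    exact add_nonneg ih (mul_nonneg (step_nonneg hη)
      (mul_nonneg (sq_nonneg _) (loss_mul_reluDeriv_mem _ _ _).1))

lemma coeffIter_ρ_nonpos (hη : 0 ≤ η) (t : ℕ) (r : Fin m) (i : Fin n) :
    (coeffIter S η W₀ t).ρ (-S.yObs i) r i ≤ 0 := by
  induction t with
  | zero => exact le_rfl
  | succ t ih =>
    rw [coeffIter_ρ_succ, sgn_neg, neg_mul (sgn _), sgn_mul_self, mul_neg_one]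
    have := mul_nonneg (step_nonneg (n := n) (m := m) hη) (mul_nonneg (sq_nonneg ‖S.noise i‖)
      (loss_mul_reluDeriv_mem (S := S) (gdIter S η W₀ t) i
        (inner ℝ (gdIter S η W₀ t (-S.yObs i) r) (S.noise i))).1)
    linarith

/-- Conditions under which the first `T` steps of gradient descent move the weights by an amount of
order `s`, where `v` is the squared norm of the noise patches. -/
structure FirstStage (ε v K s : ℝ) (S : TrainingSet n d) (η : ℝ) (W₀ : Weights m d) (T : ℕ) :
    Prop where
  n_pos : 0 < n
  m_pos : 0 < m
  η_nonneg : 0 ≤ η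
  ε_nonneg : 0 ≤ ε
  ε_le : ε ≤ 1 / 8
  v_pos : 0 < v
  signal_pos : 0 < ‖S.signal‖ ^ 2
  ortho : NearlyOrthogonal ε v S.signal S.noise
  init : SmallInit ε S.signal S.noise W₀
  signal_le : n * ‖S.signal‖ ^ 2 ≤ K * v
  time_le : T * (η / (n * m) * v) ≤ s
  small : s * (K + 4) ≤ 1

namespace FirstStage

variable {ε v K s : ℝ} {T t : ℕ}

lemma noise_le (H : FirstStage ε v K s S η W₀ T) (i : Fin n) : ‖S.noise i‖ ^ 2 ≤ (1 + ε) * v := by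
  linarith [(abs_le.1 (H.ortho.norm_sq i)).2]

lemma le_noise (H : FirstStage ε v K s S η W₀ T) (i : Fin n) : (1 - ε) * v ≤ ‖S.noise i‖ ^ 2 := by
  linarith [(abs_le.1 (H.ortho.norm_sq i)).1]

lemma K_nonneg (H : FirstStage ε v K s S η W₀ T) : 0 ≤ K := by
  have h1 := H.signal_le
  have h2 := H.v_pos
  by_contra h
  push Not at h
  have : (0 : ℝ) ≤ n * ‖S.signal‖ ^ 2 := by positivity
  nlinarith

lemma step_nonneg (H : FirstStage ε v K s S η W₀ T) : 0 ≤ η / (n * m : ℝ) :=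
  LabelNoiseCNN.step_nonneg H.η_nonneg

lemma s_nonneg (H : FirstStage ε v K s S η W₀ T) : 0 ≤ s :=
  (mul_nonneg (Nat.cast_nonneg _) (mul_nonneg H.step_nonneg H.v_pos.le)).trans H.time_le

lemma time_le' (H : FirstStage ε v K s S η W₀ T) (ht : t ≤ T) : t * (η / (n * m) * v) ≤ s := by
  refine le_trans ?_ H.time_le
  have := mul_nonneg H.step_nonneg H.v_pos.le
  gcongr

lemma isDecomposition (H : FirstStage ε v K s S η W₀ T) (t : ℕ) :
    IsDecomposition S W₀ (gdIter S η W₀ t) (coeffIter S η W₀ t) :=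
  isDecomposition_coeffIter H.signal_pos.ne'
    (fun i => by
      have := H.ortho.half_le (H.ε_le.trans (by norm_num)) H.v_pos i
      linarith [H.v_pos]) t

/-- An a priori bound from `-ℓ' ≤ 1` alone. It makes the network small, and the sharp rates with
`-ℓ' ≈ 1 / 2` are derived from that. -/
lemma abs_ρ_le (H : FirstStage ε v K s S η W₀ T) (ht : t ≤ T) (j : ℤˣ) (r : Fin m) (i : Fin n) :
    |(coeffIter S η W₀ t).ρ j r i| ≤ 2 * s := by
  refine (abs_coeffIter_ρ_le H.η_nonneg t j r i).trans ?_
  have h1 := H.time_le' ht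
  have h0 := H.s_nonneg
  have hε := H.ε_le
  have h2 : (t : ℝ) * (η / (n * m) * ‖S.noise i‖ ^ 2) ≤ t * (η / (n * m) * ((1 + ε) * v)) := by
    have := H.step_nonneg
    gcongr
    exact H.noise_le i
  have h3 : (t : ℝ) * (η / (n * m) * ((1 + ε) * v)) = (1 + ε) * (t * (η / (n * m) * v)) := by ring
  have h4 : (1 + ε) * (t * (η / (n * m) * v)) ≤ (1 + ε) * s :=
    mul_le_mul_of_nonneg_left h1 (by linarith [H.ε_nonneg])
  nlinarith

lemma abs_γ_le (H : FirstStage ε v K s S η W₀ T) (ht : t ≤ T) (j : ℤˣ) (r : Fin m) :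
    |(coeffIter S η W₀ t).γ j r| ≤ s * K := by
  refine (abs_coeffIter_γ_le H.η_nonneg t j r).trans ?_
  have h2 : (t : ℝ) * (η / (n * m) * (n * ‖S.signal‖ ^ 2)) ≤ t * (η / (n * m) * (K * v)) := by
    exact mul_le_mul_of_nonneg_left (mul_le_mul_of_nonneg_left H.signal_le H.step_nonneg)
      (Nat.cast_nonneg _)
  calc _ ≤ _ := h2
    _ = t * (η / (n * m) * v) * K := by ring
    _ ≤ s * K := mul_le_mul_of_nonneg_right (H.time_le' ht) H.K_nonneg

lemma abs_sgn_mul_γ_le (H : FirstStage ε v K s S η W₀ T) (ht : t ≤ T) (j : ℤˣ) (r : Fin m) :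
    |sgn j * (coeffIter S η W₀ t).γ j r| ≤ s * K := by
  rw [abs_mul, abs_sgn, one_mul]; exact H.abs_γ_le ht j r

lemma abs_inner_noise_sub_le (H : FirstStage ε v K s S η W₀ T) (ht : t ≤ T) (j : ℤˣ) (r : Fin m)
    (i : Fin n) :
    |inner ℝ (gdIter S η W₀ t j r) (S.noise i) - (coeffIter S η W₀ t).ρ j r i| ≤ 2 * ε := by
  have h1 := H.ortho.abs_inner_noise_sub_le H.n_pos H.ε_nonneg (H.ε_le.trans (by norm_num)) H.v_pos
    H.signal_pos (H.abs_sgn_mul_γ_le ht j r) (fun k => H.abs_ρ_le ht j r k) i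
  have h2 := H.init.noise j r i
  rw [isDecomposition_iff.1 (H.isDecomposition t) j r, inner_add_left, add_sub_assoc]
  refine (abs_add_le _ _).trans ((add_le_add h2 h1).trans ?_)
  -- The error is `ε` from the initialization plus `ε * (s * K + 4 * s)`, and `small` bounds the
  -- latter by `ε`.
  have := mul_le_mul_of_nonneg_left H.small H.ε_nonneg
  linarith

lemma abs_inner_signal_sub_le (H : FirstStage ε v K s S η W₀ T) (ht : t ≤ T) (j : ℤˣ)
    (r : Fin m) :
    |inner ℝ (gdIter S η W₀ t j r) S.signal - sgn j * (coeffIter S η W₀ t).γ j r| ≤ 2 * ε := by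
  have h1 := H.ortho.abs_inner_signal_sub_le (g := sgn j * (coeffIter S η W₀ t).γ j r)
    H.n_pos H.ε_nonneg (H.ε_le.trans (by norm_num)) H.v_pos
    H.signal_pos (fun k => H.abs_ρ_le ht j r k)
  have h2 := H.init.signal j r
  rw [isDecomposition_iff.1 (H.isDecomposition t) j r, inner_add_left, add_sub_assoc]
  refine (abs_add_le _ _).trans ((add_le_add h2 h1).trans ?_)
  have := mul_le_mul_of_nonneg_left H.small H.ε_nonneg
  have := mul_nonneg H.ε_nonneg (mul_nonneg H.s_nonneg H.K_nonneg)
  linarith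

lemma abs_inner_label_signal_sub_le (H : FirstStage ε v K s S η W₀ T) (ht : t ≤ T) (j a : ℤˣ)
    (r : Fin m) :
    |inner ℝ (gdIter S η W₀ t j r) (sgn a • S.signal)
      - sgn a * sgn j * (coeffIter S η W₀ t).γ j r| ≤ 2 * ε := by
  have h := H.abs_inner_signal_sub_le ht j r
  rw [inner_smul_right, mul_assoc, ← mul_sub, abs_mul, abs_sgn, one_mul]
  exact h

lemma abs_network_le (H : FirstStage ε v K s S η W₀ T) (ht : t ≤ T) (i : Fin n) :
    |network (gdIter S η W₀ t) (S.input i)| ≤ s * (K + 2) + 4 * ε := by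
  have hs := H.s_nonneg
  have hK := H.K_nonneg
  have hε := H.ε_nonneg
  refine LabelNoiseCNN.abs_network_le H.m_pos fun j r => ?_
  have h1 : relu (inner ℝ (gdIter S η W₀ t j r) (S.input i).1) ≤ s * K + 2 * ε := by
    refine relu_le (by positivity) ?_
    have a := H.abs_inner_label_signal_sub_le ht j (S.y i) r
    have b := H.abs_γ_le ht j r
    have e : |sgn (S.y i) * sgn j * (coeffIter S η W₀ t).γ j r| ≤ s * K := by
      rw [abs_mul, abs_mul, abs_sgn, abs_sgn, one_mul, one_mul]; exact b
    simp only [TrainingSet.input]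
    linarith [(abs_le.1 a).2, (abs_le.1 e).2]
  have h2 : relu (inner ℝ (gdIter S η W₀ t j r) (S.input i).2) ≤ 2 * s + 2 * ε := by
    refine relu_le (by positivity) ?_
    have a := H.abs_inner_noise_sub_le ht j r i
    have b := H.abs_ρ_le ht j r i
    simp only [TrainingSet.input]
    linarith [(abs_le.1 a).2, (abs_le.1 b).2]
  linarith

lemma abs_loss_le (H : FirstStage ε v K s S η W₀ T) (ht : t ≤ T) (i : Fin n) :
    |-lossDeriv S (gdIter S η W₀ t) i - 1 / 2| ≤ s * (K + 2) + 4 * ε :=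
  (abs_lossDeriv_add_half_le S _ i).trans (H.abs_network_le ht i)

variable {φ : ℝ}

lemma ρ_le (H : FirstStage ε v K s S η W₀ T) (hφ : s * (K + 2) + 4 * ε ≤ φ) (ht : t ≤ T)
    (r : Fin m) (i : Fin n) :
    (coeffIter S η W₀ t).ρ (S.yObs i) r i
      ≤ t * (η / (n * m) * v) * ((1 / 2 + φ) * (1 + ε)) := by
  induction t with
  | zero => simp [coeffIter]
  | succ t ih =>
    have ih := ih (by omega)
    have hl := (abs_le.1 ((H.abs_loss_le (t := t) (by omega) i).trans hφ)).2
    have hφ0 := (abs_nonneg _).trans ((H.abs_loss_le (t := t) (by omega) i).trans hφ)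
    rw [coeffIter_ρ_succ, sgn_mul_self, mul_one]
    have hh := H.step_nonneg
    have h1 : -lossDeriv S (gdIter S η W₀ t) i
        * reluDeriv (inner ℝ (gdIter S η W₀ t (S.yObs i) r) (S.noise i)) ≤ 1 / 2 + φ :=
      (mul_le_of_le_one_right (neg_lossDeriv_nonneg _ _ _) (reluDeriv_le_one _)).trans
        (by linarith)
    have h2 : η / (n * m) * (‖S.noise i‖ ^ 2 * (-lossDeriv S (gdIter S η W₀ t) i
        * reluDeriv (inner ℝ (gdIter S η W₀ t (S.yObs i) r) (S.noise i))))
        ≤ η / (n * m) * ((1 + ε) * v * (1 / 2 + φ)) := by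
      refine mul_le_mul_of_nonneg_left ?_ hh
      exact mul_le_mul (H.noise_le i) h1 (loss_mul_reluDeriv_mem _ _ _).1
        ((sq_nonneg _).trans (H.noise_le i))
    push_cast
    linarith

/-- An active neuron stays active because each step increases its inner product with `ξ_i`.
Increments are compared, not totals: the initial value may be arbitrarily close to `0`, where the
fixed error `2 * ε` would hide the sign, whereas the error of one step scales with the step. -/
lemma inner_noise_nonneg (H : FirstStage ε v K s S η W₀ T) (hφ : s * (K + 2) + 4 * ε ≤ φ)
    (hφ8 : φ ≤ 1 / 8) (hεK : ε * (K + 4) ≤ 1 / 8) {r : Fin m} {i : Fin n}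
    (h0 : 0 ≤ inner ℝ (W₀ (S.yObs i) r) (S.noise i)) (ht : t ≤ T) :
    0 ≤ inner ℝ (gdIter S η W₀ t (S.yObs i) r) (S.noise i) := by
  induction t with
  | zero => exact h0
  | succ t ih =>
    have ih := ih (by omega)
    set j := S.yObs i
    have hl := (abs_le.1 ((H.abs_loss_le (t := t) (by omega) i).trans hφ)).1
    have hh := H.step_nonneg
    set c := coeffIter S η W₀ t
    set c' := coeffIter S η W₀ (t + 1)
    have e : gdIter S η W₀ (t + 1) j r = gdIter S η W₀ t j r
        + patchComb S.signal S.noise (sgn j * (c'.γ j r - c.γ j r))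
          (fun k => c'.ρ j r k - c.ρ j r k) := by
      rw [isDecomposition_iff.1 (H.isDecomposition (t + 1)) j r,
        isDecomposition_iff.1 (H.isDecomposition t) j r]
      simp only [patchComb, sub_mul, mul_sub, sub_smul, Finset.sum_sub_distrib]
      abel
    have hγ : |sgn j * (c'.γ j r - c.γ j r)| ≤ η / (n * m) * (K * v) := by
      rw [abs_mul, abs_sgn, one_mul]
      refine (abs_coeffIter_γ_step_le H.η_nonneg t j r).trans ?_
      exact mul_le_mul_of_nonneg_left H.signal_le hh
    have hv := H.v_pos
    have hε := H.ε_le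
    have hρ : ∀ k, |c'.ρ j r k - c.ρ j r k| ≤ η / (n * m) * (2 * v) := fun k => by
      refine (abs_coeffIter_ρ_step_le H.η_nonneg t j r k).trans ?_
      gcongr
      refine (H.noise_le k).trans ?_
      gcongr
      linarith
    have key := H.ortho.abs_inner_noise_sub_le H.n_pos H.ε_nonneg (H.ε_le.trans (by norm_num))
      H.v_pos H.signal_pos hγ hρ i
    have hstep : c'.ρ j r i - c.ρ j r i
        = η / (n * m) * (‖S.noise i‖ ^ 2 * (-lossDeriv S (gdIter S η W₀ t) i)) := by
      simp only [c', c]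
      -- The convention `σ'(0) = 1` makes `0 ≤` a sufficient invariant.
      rw [coeffIter_ρ_succ, add_sub_cancel_left, sgn_mul_self, reluDeriv, if_pos ih]
      ring
    -- The gain is at least `(7 / 8) * (3 / 8) * v` in units of the step, while cross terms cost `ε
    -- * (K + 4) * v ≤ v / 8`.
    have hlow : η / (n * m) * (1 / 8 * v)
        ≤ η / (n * m) * (‖S.noise i‖ ^ 2 * (-lossDeriv S (gdIter S η W₀ t) i)) := by
      refine mul_le_mul_of_nonneg_left ?_ hh
      have h1 : (7 / 8) * v ≤ ‖S.noise i‖ ^ 2 := by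
        refine le_trans ?_ (H.le_noise i)
        gcongr
        linarith
      have h2 : 3 / 8 ≤ -lossDeriv S (gdIter S η W₀ t) i := by linarith
      nlinarith [mul_le_mul h1 h2 (by norm_num) (by positivity)]
    have herr : ε * (η / (n * m) * (K * v) + 2 * (η / (n * m) * (2 * v)))
        ≤ η / (n * m) * (1 / 8 * v) := by
      have := mul_le_mul_of_nonneg_right hεK (mul_nonneg hh hv.le)
      linarith
    rw [e, inner_add_left]
    linarith [(abs_le.1 key).1]

lemma le_ρ (H : FirstStage ε v K s S η W₀ T) (hφ : s * (K + 2) + 4 * ε ≤ φ)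
    (hφ8 : φ ≤ 1 / 8) (hεK : ε * (K + 4) ≤ 1 / 8) {r : Fin m} {i : Fin n}
    (h0 : 0 ≤ inner ℝ (W₀ (S.yObs i) r) (S.noise i)) (ht : t ≤ T) :
    t * (η / (n * m) * v) * ((1 / 2 - φ) * (1 - ε)) ≤ (coeffIter S η W₀ t).ρ (S.yObs i) r i := by
  induction t with
  | zero => simp [coeffIter]
  | succ t ih =>
    have ih := ih (by omega)
    have hl := (abs_le.1 ((H.abs_loss_le (t := t) (by omega) i).trans hφ)).1
    have hact := H.inner_noise_nonneg hφ hφ8 hεK h0 (t := t) (by omega)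
    rw [coeffIter_ρ_succ, sgn_mul_self, mul_one, reluDeriv, if_pos hact, mul_one]
    have hh := H.step_nonneg
    have h2 : η / (n * m) * ((1 - ε) * v * (1 / 2 - φ))
        ≤ η / (n * m) * (‖S.noise i‖ ^ 2 * (-lossDeriv S (gdIter S η W₀ t) i)) := by
      refine mul_le_mul_of_nonneg_left ?_ hh
      exact mul_le_mul (H.le_noise i) (by linarith) (by linarith) (sq_nonneg _)
    push_cast
    linarith

end FirstStage

/-- Whatever the sign of `x`, the samples active for `x` have a margin. -/
lemma LabelMargin.le_sum_active {b : ℝ} {y yObs : Fin n → ℤˣ} (h : LabelMargin b y yObs)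
    (hb : 0 ≤ b) (x : ℝ) :
    b * n ≤ ∑ i, reluDeriv (sgn (y i) * x) * (sgn (y i) * sgn (yObs i)) := by
  have hfib : ∑ i, reluDeriv (sgn (y i) * x) * (sgn (y i) * sgn (yObs i))
      = ∑ a : ℤˣ, reluDeriv (sgn a * x) * ∑ i with y i = a, sgn (y i) * sgn (yObs i) := by
    rw [← Finset.sum_fiberwise Finset.univ y]
    refine Finset.sum_congr rfl fun a _ => ?_
    rw [Finset.mul_sum]
    refine Finset.sum_congr rfl fun i hi => ?_
    rw [(Finset.mem_filter.1 hi).2]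
  have hun : (Finset.univ : Finset ℤˣ) = {1, -1} := rfl
  have hbn : 0 ≤ b * n := by positivity
  have h1 := h 1
  have h2 := h (-1)
  rw [hfib, hun, Finset.sum_pair (by decide)]
  have r1 := reluDeriv_nonneg (sgn 1 * x)
  have r2 := reluDeriv_nonneg (sgn (-1) * x)
  -- One class is fully active. At the kink `x = 0` the other is active as well, and its nonnegative
  -- margin only helps.
  rcases le_total 0 x with hx | hx
  · have : reluDeriv (sgn 1 * x) = 1 := if_pos (by simpa [sgn] using hx)
    rw [this]
    linarith [mul_nonneg r2 (hbn.trans h2)]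
  · have : reluDeriv (sgn (-1) * x) = 1 := if_pos (by simpa [sgn] using hx)
    rw [this]
    linarith [mul_nonneg r1 (hbn.trans h1)]

/-- Replacing each `-ℓ'` by `1 / 2` costs at most `φ` per sample, and what remains is half the
margin of the active samples. The activation pattern may change with `t`, since the margin bound
holds for either sign. -/
lemma FirstStage.le_γ {ε v K s φ b : ℝ} {T t : ℕ} (H : FirstStage ε v K s S η W₀ T)
    (hL : LabelMargin b S.y S.yObs) (hb : 0 ≤ b) (hφ : s * (K + 2) + 4 * ε ≤ φ) (ht : t ≤ T)
    (j : ℤˣ) (r : Fin m) :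
    t * (η / (n * m) * (n * ‖S.signal‖ ^ 2)) * (b / 2 - φ) ≤ (coeffIter S η W₀ t).γ j r := by
  induction t with
  | zero => simp [coeffIter]
  | succ t ih =>
    have ih := ih (by omega)
    rw [coeffIter_γ_succ]
    set W := gdIter S η W₀ t
    have hsum : n * (b / 2 - φ) ≤ ∑ i, -lossDeriv S W i
          * reluDeriv (inner ℝ (W j r) (sgn (S.y i) • S.signal))
          * (sgn (S.y i) * sgn (S.yObs i)) := by
      have hact := hL.le_sum_active hb (inner ℝ (W j r) S.signal)
      have hterm : ∀ i, 1 / 2 * (reluDeriv (sgn (S.y i) * inner ℝ (W j r) S.signal)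
          * (sgn (S.y i) * sgn (S.yObs i))) - φ ≤ -lossDeriv S W i
          * reluDeriv (inner ℝ (W j r) (sgn (S.y i) • S.signal))
          * (sgn (S.y i) * sgn (S.yObs i)) := by
        intro i
        rw [inner_smul_right]
        set ρ := reluDeriv (sgn (S.y i) * inner ℝ (W j r) S.signal)
        have hl := (H.abs_loss_le (t := t) (by omega) i).trans hφ
        have habs : |(-lossDeriv S W i - 1 / 2) * (ρ * (sgn (S.y i) * sgn (S.yObs i)))| ≤ φ := by
          rw [abs_mul, abs_mul, abs_mul (sgn _), abs_sgn, abs_sgn, mul_one, mul_one,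
            abs_of_nonneg (reluDeriv_nonneg _)]
          exact (mul_le_of_le_one_right (abs_nonneg _) (reluDeriv_le_one _)).trans hl
        linarith [(abs_le.1 habs).1]
      have := Finset.sum_le_sum fun i (_ : i ∈ (Finset.univ : Finset (Fin n))) => hterm i
      rw [Finset.sum_sub_distrib, ← Finset.mul_sum] at this
      simp only [Finset.sum_const, Finset.card_univ, Fintype.card_fin, nsmul_eq_mul] at this
      linarith
    have h2 := mul_le_mul_of_nonneg_left (mul_le_mul_of_nonneg_left hsum (sq_nonneg ‖S.signal‖))
      H.step_nonneg
    push_cast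
    linarith

end FirstStage

/-! ### Signal against noise at the end of the first stage -/

section Outcome

variable {n m d : ℕ} {S : TrainingSet n d} {η : ℝ} {W₀ : Weights m d}

/-- If the signal coefficients exceed the noise coefficients by more than the near-orthogonality
error, the network agrees with the true labels after the first stage. -/
theorem FirstStage.outcome {ε v K s θ b k lo hi : ℝ} {T : ℕ} (H : FirstStage ε v K s S η W₀ T)
    (hs : s = T * (η / (n * m) * v)) (hL : LabelMargin b S.y S.yObs) (hθ : 0 < θ)
    (hθ8 : θ ≤ 1 / 8) (hφ : s * (K + 2) + 4 * ε ≤ θ) (hεK : ε * (K + 4) ≤ 1 / 8)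
    (hk : k * v ≤ n * ‖S.signal‖ ^ 2) (hb : 0 ≤ b / 2 - θ)
    (gap : (1 / 2 + θ) * (1 + ε) + θ ≤ k * (b / 2 - θ)) (hspos : 0 < s) (hε : 8 * ε ≤ s * θ)
    (hlo : lo ≤ s / 4) (hhi : s * (K + 2) ≤ hi) : StageOneOutcome lo hi S η W₀ T := by
  have hε0 := H.ε_nonneg
  have hε8 := H.ε_le
  set c := coeffIter S η W₀ T with hc
  have hdec : IsDecomposition S W₀ (gdIter S η W₀ T) c := H.isDecomposition T
  have huniq : ∀ c', IsDecomposition S W₀ (gdIter S η W₀ T) c' → c' = c := fun c' h' =>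
    H.ortho.decomposition_unique H.n_pos hε0 (hε8.trans (by norm_num)) H.v_pos H.signal_pos h' hdec
  -- In units of `s`, `gap` compares the upper rate of the noise with the lower rate of the signal;
  -- the surplus `s * θ` is what absorbs all errors below.
  have hγ : ∀ j r, s * ((1 / 2 + θ) * (1 + ε)) + s * θ ≤ c.γ j r := by
    intro j r
    refine le_trans ?_ (H.le_γ hL (by linarith) hφ le_rfl j r)
    have h1 : (T : ℝ) * (η / (n * m) * (k * v)) * (b / 2 - θ)
        ≤ T * (η / (n * m) * (n * ‖S.signal‖ ^ 2)) * (b / 2 - θ) :=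
      mul_le_mul_of_nonneg_right (mul_le_mul_of_nonneg_left
        (mul_le_mul_of_nonneg_left hk H.step_nonneg) (Nat.cast_nonneg _)) hb
    have h2 := mul_le_mul_of_nonneg_left gap hspos.le
    have h3 : (T : ℝ) * (η / (n * m) * (k * v)) * (b / 2 - θ) = s * (k * (b / 2 - θ)) := by
      rw [hs]; ring
    linarith
  have hρ : ∀ r i, c.ρ (S.yObs i) r i ≤ s * ((1 / 2 + θ) * (1 + ε)) := by
    intro r i
    have := H.ρ_le hφ le_rfl r i
    rwa [← hs] at this
  have hρ0 : ∀ r i, 0 ≤ c.ρ (S.yObs i) r i := fun r i => coeffIter_ρ_nonneg H.η_nonneg T r i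
  have hpos : ∀ r i, c.ρpos (S.yObs i) r i = c.ρ (S.yObs i) r i := fun r i => if_pos (hρ0 r i)
  have hsθ : 0 < s * θ := mul_pos hspos hθ
  have hU : s / 4 ≤ s * ((1 / 2 + θ) * (1 + ε)) := by
    have : (1 : ℝ) / 4 ≤ (1 / 2 + θ) * (1 + ε) := by nlinarith
    nlinarith
  have hK := H.K_nonneg
  refine ⟨⟨c, hdec, huniq⟩, ?_, ?_, ?_⟩
  · intro c' h'
    obtain rfl := huniq c' h'
    refine ⟨fun i r h0 => ?_, fun j r => ?_, fun j r r' i => ?_⟩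
    · rw [hpos]
      refine ⟨hlo.trans ?_, ?_⟩
      · have := H.le_ρ hφ hθ8 hεK h0 le_rfl
        rw [← hs] at this
        refine le_trans ?_ this
        have : (1 : ℝ) / 4 ≤ (1 / 2 - θ) * (1 - ε) := by nlinarith
        nlinarith
      · have := (abs_le.1 (H.abs_ρ_le le_rfl (S.yObs i) r i)).2
        nlinarith
    · refine ⟨by linarith [hγ j r], ?_⟩
      have := (abs_le.1 (H.abs_γ_le le_rfl j r)).2
      nlinarith
    · rw [hpos]
      linarith [hγ j r, hρ r' i]
  · intro i hi
    rw [sgn_mul_network, sub_nonneg]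
    have h1 : s * θ ≤ branch (gdIter S η W₀ T) (S.yObs i) (S.input i) := by
      refine le_branch H.m_pos fun r => ?_
      have h := (abs_le.1 (H.abs_inner_label_signal_sub_le le_rfl (S.yObs i) (S.y i) r)).1
      rw [hi, sgn_mul_self, one_mul] at h
      have h' := le_relu (inner ℝ (gdIter S η W₀ T (S.y i) r) (sgn (S.y i) • S.signal))
      have h'' := relu_nonneg (inner ℝ (gdIter S η W₀ T (S.yObs i) r) (S.input i).2)
      have hg := hγ (S.y i) r
      have e1 : s * (1 / 4) ≥ 2 * ε := by nlinarith
      simp only [TrainingSet.input] at h'' ⊢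
      rw [hi] at h'' ⊢
      linarith
    -- On the opposite branch both pre-activations are negative up to `2 * ε`: the signal one is
    -- about `-γ`, the noise one about `ρ ≤ 0`.
    refine le_trans (branch_le H.m_pos (b := 4 * ε) fun r => ?_) (le_trans (by linarith) h1)
    have ha : relu (inner ℝ (gdIter S η W₀ T (-S.yObs i) r) (S.input i).1) ≤ 2 * ε := by
      refine relu_le (by positivity) ?_
      have h := (abs_le.1 (H.abs_inner_label_signal_sub_le le_rfl (-S.yObs i) (S.y i) r)).2
      rw [hi, sgn_neg, mul_neg, sgn_mul_self, neg_one_mul] at h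
      have hg := hγ (-S.y i) r
      simp only [TrainingSet.input]
      rw [hi]
      linarith
    have hb : relu (inner ℝ (gdIter S η W₀ T (-S.yObs i) r) (S.input i).2) ≤ 2 * ε := by
      refine relu_le (by positivity) ?_
      have h := (abs_le.1 (H.abs_inner_noise_sub_le le_rfl (-S.yObs i) r i)).2
      have hneg := coeffIter_ρ_nonpos (S := S) (W₀ := W₀) H.η_nonneg T r i
      simp only [TrainingSet.input]
      linarith
    linarith
  · intro i hi
    have hy : S.y i = -S.yObs i := by
      rcases Int.units_eq_one_or (S.y i) with h | h <;>
        rcases Int.units_eq_one_or (S.yObs i) with h' | h' <;> simp_all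
    rw [sgn_mul_network, sub_nonpos]
    -- For a flipped label the signal feeds the branch of the true label and the noise that of the
    -- observed one. The errors add up to `6 * ε`, less than `s * θ`.
    have h1 : s * ((1 / 2 + θ) * (1 + ε)) + s * θ - 2 * ε
        ≤ branch (gdIter S η W₀ T) (-S.yObs i) (S.input i) := by
      refine le_branch H.m_pos fun r => ?_
      have h := (abs_le.1 (H.abs_inner_label_signal_sub_le le_rfl (-S.yObs i) (S.y i) r)).1
      rw [hy, sgn_mul_self, one_mul] at h
      have h' := le_relu (inner ℝ (gdIter S η W₀ T (-S.yObs i) r) (sgn (-S.yObs i) • S.signal))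
      have h'' := relu_nonneg (inner ℝ (gdIter S η W₀ T (-S.yObs i) r) (S.input i).2)
      have hg := hγ (-S.yObs i) r
      simp only [TrainingSet.input] at h'' ⊢
      rw [hy]
      linarith
    refine le_trans (branch_le H.m_pos (b := s * ((1 / 2 + θ) * (1 + ε)) + 4 * ε) fun r => ?_)
      (le_trans (by linarith) h1)
    have ha : relu (inner ℝ (gdIter S η W₀ T (S.yObs i) r) (S.input i).1) ≤ 2 * ε := by
      refine relu_le (by positivity) ?_
      have h := (abs_le.1 (H.abs_inner_label_signal_sub_le le_rfl (S.yObs i) (S.y i) r)).2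
      rw [hy, sgn_neg, neg_mul (sgn _), sgn_mul_self, neg_one_mul] at h
      have hg := hγ (S.yObs i) r
      simp only [TrainingSet.input]
      rw [hy, sgn_neg]
      linarith
    have hb : relu (inner ℝ (gdIter S η W₀ T (S.yObs i) r) (S.input i).2)
        ≤ s * ((1 / 2 + θ) * (1 + ε)) + 2 * ε := by
      refine relu_le (by positivity) ?_
      have h := (abs_le.1 (H.abs_inner_noise_sub_le le_rfl (S.yObs i) r i)).2
      simp only [TrainingSet.input]
      linarith [hρ r i]
    linarith

end Outcome

/-! ### Gaussian concentration -/

section Gaussian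

variable {d : ℕ}

instance isProbabilityMeasure_isoGaussian (d : ℕ) (σ : ℝ) :
    IsProbabilityMeasure (isoGaussian d σ) :=
  Measure.isProbabilityMeasure_map (by fun_prop)

lemma stdGaussian_map_inner (v : Patch d) :
    (stdGaussian (Patch d)).map (fun x => inner ℝ x v) = gaussianReal 0 (‖v‖ ^ 2).toNNReal := by
  have h := IsGaussian.map_eq_gaussianReal (μ := stdGaussian (Patch d)) (innerSL ℝ v)
  rw [integral_strongDual_stdGaussian, variance_dual_stdGaussian, innerSL_apply_norm] at h
  rw [← h]
  congr 1
  funext x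
  exact real_inner_comm _ _

lemma isoGaussian_map_inner (σ : ℝ) (v : Patch d) :
    (isoGaussian d σ).map (fun x => inner ℝ x v) = gaussianReal 0 (σ ^ 2 * ‖v‖ ^ 2).toNNReal := by
  have h := stdGaussian_map_inner (σ • v)
  rw [norm_smul, mul_pow, Real.norm_eq_abs, sq_abs] at h
  rw [isoGaussian, Measure.map_map (by fun_prop) (by fun_prop), ← h]
  congr 1
  funext x
  simp [inner_smul_left, inner_smul_right]

lemma measure_abs_gt_le {Ω : Type*} [MeasurableSpace Ω] {P : Measure Ω} [IsProbabilityMeasure P]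
    {X : Ω → ℝ} (hX : Measurable X) {v : NNReal} (h : P.map X = gaussianReal 0 v) {t a : ℝ}
    (hv : v ≠ 0) (ht : 0 ≤ t) (ha : 2 * v * a ≤ t ^ 2) :
    P {ω | t < |X ω|} ≤ ENNReal.ofReal (2 * Real.exp (-a)) := by
  have hsub : HasSubgaussianMGF X v P :=
    { integrable_exp_mul := fun s => by
        have := integrable_exp_mul_gaussianReal (μ := 0) (v := v) s
        rw [← h] at this
        exact this.comp_measurable hX
      mgf_le := fun s => by rw [mgf_gaussianReal h]; simp }
  have hv' : (0 : ℝ) < v := by positivity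
  have hexp : Real.exp (-t ^ 2 / (2 * v)) ≤ Real.exp (-a) := by
    rw [Real.exp_le_exp, div_le_iff₀ (by positivity)]
    linarith
  have h1 := (hsub.measure_ge_le ht).trans hexp
  have h2 := (hsub.neg.measure_ge_le ht).trans hexp
  have hsubset : {ω | t < |X ω|} ⊆ {ω | t ≤ X ω} ∪ {ω | t ≤ (-X) ω} := by
    intro ω hω
    rcases lt_abs.1 (show t < |X ω| from hω) with h | h
    · exact Or.inl h.le
    · exact Or.inr h.le
  rw [← ofReal_measureReal (measure_ne_top _ _)]
  refine ENNReal.ofReal_le_ofReal ?_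
  calc P.real {ω | t < |X ω|} ≤ P.real ({ω | t ≤ X ω} ∪ {ω | t ≤ (-X) ω}) :=
        measureReal_mono hsubset
    _ ≤ _ := measureReal_union_le _ _
    _ ≤ _ := by linarith

/-- Gaussian tail bound for a linear functional of an isotropic Gaussian vector. -/
lemma isoGaussian_abs_inner_gt_le {σ : ℝ} (hσ : 0 < σ) (v : Patch d) {t a : ℝ} (ht : 0 ≤ t)
    (ha : 2 * (σ ^ 2 * ‖v‖ ^ 2) * a ≤ t ^ 2) :
    isoGaussian d σ {x | t < |inner ℝ x v|} ≤ ENNReal.ofReal (2 * Real.exp (-a)) := by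
  rcases eq_or_ne v 0 with rfl | hv
  · have : {x : Patch d | t < |inner ℝ x (0 : Patch d)|} = ∅ := by
      ext x; simpa using ht
    rw [this, measure_empty]
    exact zero_le
  · have hpos : 0 < σ ^ 2 * ‖v‖ ^ 2 := by
      have := norm_pos_iff.2 hv
      positivity
    refine measure_abs_gt_le (by fun_prop) (isoGaussian_map_inner σ v) ?_ ht ?_
    · simpa using hpos
    · rwa [Real.coe_toNNReal _ hpos.le]

/-- Tail bound for the inner product of independent vectors, the first an isotropic Gaussian. -/
lemma measure_abs_inner_gt_le_of_indep {Ω : Type*} [MeasurableSpace Ω] {P : Measure Ω} {σ : ℝ}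
    (hσ : 0 < σ) {ν : Measure (Patch d)} [IsProbabilityMeasure ν] {X Y : Ω → Patch d}
    (h : MeasurePreserving (fun ω => (X ω, Y ω)) P ((isoGaussian d σ).prod ν)) {t a Q : ℝ}
    (ht : 0 ≤ t) (ha0 : 0 ≤ a) (ha : 2 * (σ ^ 2 * Q) * a ≤ t ^ 2) :
    P {ω | ‖Y ω‖ ^ 2 ≤ Q ∧ t < |inner ℝ (X ω) (Y ω)|} ≤ ENNReal.ofReal (2 * Real.exp (-a)) := by
  have hmeas : MeasurableSet {p : Patch d × Patch d | ‖p.2‖ ^ 2 ≤ Q ∧ t < |inner ℝ p.1 p.2|} := by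
    apply MeasurableSet.inter
    · exact measurableSet_le (f := fun p : Patch d × Patch d => ‖p.2‖ ^ 2) (g := fun _ => Q)
        (by fun_prop) (by fun_prop)
    · exact measurableSet_lt (f := fun _ => t) (g := fun p : Patch d × Patch d => |inner ℝ p.1 p.2|)
        (by fun_prop) (by fun_prop)
  have e := h.measure_preimage hmeas.nullMeasurableSet
  refine (le_of_eq e).trans ?_
  -- By Fubini the second vector is frozen at `y`: the inner product is Gaussian with variance at
  -- most `σ ^ 2 * Q`, or the section is empty.
  rw [Measure.prod_apply_symm hmeas]
  calc _ ≤ ∫⁻ _y, ENNReal.ofReal (2 * Real.exp (-a)) ∂ν := by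
        refine lintegral_mono fun y => ?_
        by_cases hy : ‖y‖ ^ 2 ≤ Q
        · refine (measure_mono (fun x hx => hx.2)).trans
            (isoGaussian_abs_inner_gt_le hσ y ht (le_trans ?_ ha))
          gcongr
        · have : (fun x => (x, y)) ⁻¹' {p : Patch d × Patch d |
              ‖p.2‖ ^ 2 ≤ Q ∧ t < |inner ℝ p.1 p.2|} = ∅ := by
            ext x; simp [hy]
          simp [this]
    _ = _ := by simp

/-! ### Chi-square concentration -/

lemma neg_sub_two_mul_sq_le_log {u : ℝ} (hu : u ≤ 1 / 2) : -u - 2 * u ^ 2 ≤ Real.log (1 - u) := by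
  have h1 : 0 < 1 - u := by linarith
  refine le_trans ?_ (Real.one_sub_inv_le_log_of_pos h1)
  rw [← sub_nonneg]
  have : 1 - (1 - u)⁻¹ - (-u - 2 * u ^ 2) = u ^ 2 * (1 - 2 * u) / (1 - u) := by
    field_simp; ring
  rw [this]
  exact div_nonneg (mul_nonneg (sq_nonneg _) (by linarith)) h1.le

lemma integral_exp_mul_sq_gaussianReal {l : ℝ} (hl : l < 1 / 2) :
    ∫ x, Real.exp (l * x ^ 2) ∂gaussianReal 0 1 = √(1 / (1 - 2 * l)) := by
  rw [integral_gaussianReal_eq_integral_smul (by norm_num)]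
  have e : ∀ x : ℝ, gaussianPDFReal 0 1 x • Real.exp (l * x ^ 2)
      = (√(2 * Real.pi))⁻¹ * Real.exp (-(1 / 2 - l) * x ^ 2) := by
    intro x
    simp only [gaussianPDFReal, NNReal.coe_one, mul_one, sub_zero, smul_eq_mul]
    rw [mul_assoc, ← Real.exp_add]
    congr 2
    ring
  simp_rw [e]
  rw [integral_const_mul, integral_gaussian, ← Real.sqrt_inv, ← Real.sqrt_mul (by positivity)]
  congr 1
  have : 1 - 2 * l ≠ 0 := by linarith
  have : 1 / 2 - l ≠ 0 := by linarith
  have := Real.pi_pos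
  field_simp

/-- A non-integrable function has integral `0` by convention, so the positive closed form certifies
integrability. -/
lemma integrable_exp_mul_sq_gaussianReal {l : ℝ} (hl : l < 1 / 2) :
    Integrable (fun x => Real.exp (l * x ^ 2)) (gaussianReal 0 1) := by
  refine Integrable.of_integral_ne_zero ?_
  rw [integral_exp_mul_sq_gaussianReal hl]
  have : 0 < 1 - 2 * l := by linarith
  positivity

/-- The logarithm of the closed form is `-log (1 - 2 * l) / 2`. Negative `l` is allowed, for the
lower tail. -/
lemma mgf_sq_gaussianReal_le {l : ℝ} (hl : l ≤ 1 / 4) :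
    ∫ x, Real.exp (l * x ^ 2) ∂gaussianReal 0 1 ≤ Real.exp (l + 4 * l ^ 2) := by
  rw [integral_exp_mul_sq_gaussianReal (by linarith)]
  have h0 : 0 < 1 - 2 * l := by linarith
  have h := neg_sub_two_mul_sq_le_log (u := 2 * l) (by linarith)
  rw [Real.sqrt_le_left (Real.exp_pos _).le, ← Real.exp_nat_mul, one_div, ← Real.exp_log h0,
    ← Real.exp_neg, Real.exp_le_exp]
  push_cast
  linarith

lemma mgf_sum_sq_le {l : ℝ} (hl : l ≤ 1 / 4) :
    Integrable (fun x : Fin d → ℝ => Real.exp (l * ∑ i, x i ^ 2))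
      (Measure.pi fun _ => gaussianReal 0 1) ∧
    ∫ x : Fin d → ℝ, Real.exp (l * ∑ i, x i ^ 2) ∂(Measure.pi fun _ => gaussianReal 0 1)
      ≤ Real.exp (d * (l + 4 * l ^ 2)) := by
  have e : (fun x : Fin d → ℝ => Real.exp (l * ∑ i, x i ^ 2))
      = fun x => ∏ i, Real.exp (l * x i ^ 2) := by
    funext x
    rw [Finset.mul_sum, Real.exp_sum]
  rw [e]
  refine ⟨Integrable.fintype_prod fun _ => integrable_exp_mul_sq_gaussianReal (by linarith), ?_⟩
  rw [integral_fintype_prod_eq_prod (fun _ : Fin d => fun x : ℝ => Real.exp (l * x ^ 2))]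
  rw [Finset.prod_const, Finset.card_univ, Fintype.card_fin, Real.exp_nat_mul]
  exact pow_le_pow_left₀ (integral_nonneg fun x => (Real.exp_pos _).le)
    (mgf_sq_gaussianReal_le hl) _

lemma pi_abs_sum_sq_sub_gt_le {ε : ℝ} (hε : 0 ≤ ε) (hε1 : ε ≤ 1) :
    (Measure.pi fun _ : Fin d => gaussianReal 0 1) {x | ε * d < |∑ i, x i ^ 2 - d|}
      ≤ ENNReal.ofReal (2 * Real.exp (-(ε ^ 2 * d / 16))) := by
  -- Chernoff's bound at `l = ± ε / 8`, which minimizes `4 * l ^ 2 - ε * |l|`.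
  set P := Measure.pi fun _ : Fin d => gaussianReal 0 1
  obtain ⟨i1, b1⟩ := mgf_sum_sq_le (d := d) (l := ε / 8) (by linarith)
  obtain ⟨i2, b2⟩ := mgf_sum_sq_le (d := d) (l := -(ε / 8)) (by linarith)
  have h1 := measure_ge_le_exp_mul_mgf (μ := P) (X := fun x => ∑ i, x i ^ 2) ((1 + ε) * d)
    (by linarith : 0 ≤ ε / 8) i1
  have h2 := measure_le_le_exp_mul_mgf (μ := P) (X := fun x => ∑ i, x i ^ 2) ((1 - ε) * d)
    (by linarith : -(ε / 8) ≤ 0) i2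
  have h1' : P.real {x | (1 + ε) * d ≤ ∑ i, x i ^ 2} ≤ Real.exp (-(ε ^ 2 * d / 16)) := by
    refine h1.trans ((mul_le_mul_of_nonneg_left b1 (Real.exp_pos _).le).trans_eq ?_)
    rw [← Real.exp_add]
    congr 1
    ring
  have h2' : P.real {x | ∑ i, x i ^ 2 ≤ (1 - ε) * d} ≤ Real.exp (-(ε ^ 2 * d / 16)) := by
    refine h2.trans ((mul_le_mul_of_nonneg_left b2 (Real.exp_pos _).le).trans_eq ?_)
    rw [← Real.exp_add]
    congr 1
    ring
  have hsubset : {x : Fin d → ℝ | ε * d < |∑ i, x i ^ 2 - d|}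
      ⊆ {x | (1 + ε) * d ≤ ∑ i, x i ^ 2} ∪ {x | ∑ i, x i ^ 2 ≤ (1 - ε) * d} := by
    intro x hx
    rcases lt_abs.1 (show ε * d < |∑ i, x i ^ 2 - d| from hx) with h | h
    · left; change (1 + ε) * d ≤ ∑ i, x i ^ 2; linarith
    · right; change ∑ i, x i ^ 2 ≤ (1 - ε) * d; linarith
  rw [← ofReal_measureReal (measure_ne_top _ _)]
  refine ENNReal.ofReal_le_ofReal ?_
  calc _ ≤ _ := measureReal_mono hsubset
    _ ≤ _ := measureReal_union_le _ _
    _ ≤ _ := by linarith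

/-- Concentration of the squared norm of an isotropic Gaussian vector. -/
lemma isoGaussian_abs_norm_sq_sub_gt_le {σ ε : ℝ} (hσ : 0 < σ) (hε : 0 ≤ ε) (hε1 : ε ≤ 1) :
    isoGaussian d σ {x | ε * (σ ^ 2 * d) < |‖x‖ ^ 2 - σ ^ 2 * d|}
      ≤ ENNReal.ofReal (2 * Real.exp (-(ε ^ 2 * d / 16))) := by
  have hm : MeasurableSet {x : Patch d | ε * (σ ^ 2 * d) < |‖x‖ ^ 2 - σ ^ 2 * d|} :=
    measurableSet_lt (by fun_prop) (by fun_prop)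
  rw [isoGaussian, ← map_pi_eq_stdGaussian, Measure.map_map (by fun_prop) (by fun_prop),
    Measure.map_apply (by fun_prop) hm]
  refine (measure_mono fun x hx => ?_).trans (pi_abs_sum_sq_sub_gt_le (d := d) hε hε1)
  have hσ2 : 0 < σ ^ 2 := by positivity
  simp only [Set.mem_preimage, Function.comp_apply, Set.mem_ofPred_eq, norm_smul, mul_pow,
    Real.norm_eq_abs, sq_abs] at hx ⊢
  simp only [EuclideanSpace.norm_sq_eq, Real.norm_eq_abs, sq_abs] at hx
  rw [← mul_sub, abs_mul, abs_of_pos hσ2, mul_left_comm] at hx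
  exact lt_of_mul_lt_mul_left hx hσ2.le

end Gaussian

/-! ### Good events -/

section GoodEvents

lemma measure_exists_le {Ω ι : Type*} [MeasurableSpace Ω] [Fintype ι] (P : Measure Ω)
    {p : ι → Ω → Prop} {b : ℝ} (h : ∀ i, P {ω | p i ω} ≤ ENNReal.ofReal b) :
    P {ω | ∃ i, p i ω} ≤ ENNReal.ofReal (Fintype.card ι * b) := by
  have e : {ω | ∃ i, p i ω} = ⋃ i, {ω | p i ω} := by ext; simp
  rw [e]
  refine (measure_iUnion_fintype_le P _).trans ((Finset.sum_le_sum fun i _ => h i).trans ?_)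
  rw [Finset.sum_const, Finset.card_univ, nsmul_eq_mul, ENNReal.ofReal_mul (Nat.cast_nonneg _),
    ENNReal.ofReal_natCast]

lemma measure_or_le {Ω : Type*} [MeasurableSpace Ω] (P : Measure Ω) {p q : Ω → Prop} {a b : ℝ}
    (ha : 0 ≤ a) (hb : 0 ≤ b) (hp : P {ω | p ω} ≤ ENNReal.ofReal a)
    (hq : P {ω | q ω} ≤ ENNReal.ofReal b) : P {ω | p ω ∨ q ω} ≤ ENNReal.ofReal (a + b) := by
  rw [ENNReal.ofReal_add ha hb]
  exact (measure_union_le {ω | p ω} {ω | q ω}).trans (add_le_add hp hq)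

variable {n m d : ℕ} {σξ σ0 : ℝ}

instance isProbabilityMeasure_noiseInitLaw :
    IsProbabilityMeasure (noiseInitLaw n m d σξ σ0) := by
  unfold noiseInitLaw; infer_instance

lemma measurePreserving_noise (i : Fin n) :
    MeasurePreserving (fun ω : (Fin n → Patch d) × Weights m d => ω.1 i)
      (noiseInitLaw n m d σξ σ0) (isoGaussian d σξ) :=
  (measurePreserving_eval (fun _ : Fin n => isoGaussian d σξ) i).comp measurePreserving_fst

lemma measurePreserving_weight (j : ℤˣ) (r : Fin m) :
    MeasurePreserving (fun W : Weights m d => W j r)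
      (Measure.pi fun _ : ℤˣ => Measure.pi fun _ : Fin m => isoGaussian d σ0)
      (isoGaussian d σ0) :=
  (measurePreserving_eval (fun _ : Fin m => isoGaussian d σ0) r).comp
    (measurePreserving_eval (fun _ : ℤˣ => Measure.pi fun _ : Fin m => isoGaussian d σ0) j)

lemma measurePreserving_init (j : ℤˣ) (r : Fin m) :
    MeasurePreserving (fun ω : (Fin n → Patch d) × Weights m d => ω.2 j r)
      (noiseInitLaw n m d σξ σ0) (isoGaussian d σ0) :=
  (measurePreserving_weight j r).comp measurePreserving_snd

lemma measurePreserving_noise_noise {i k : Fin n} (hik : i ≠ k) :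
    MeasurePreserving (fun ω : (Fin n → Patch d) × Weights m d => (ω.1 i, ω.1 k))
      (noiseInitLaw n m d σξ σ0) ((isoGaussian d σξ).prod (isoGaussian d σξ)) := by
  have hind := (iIndepFun_pi (μ := fun _ : Fin n => isoGaussian d σξ) (X := fun _ x => x)
    (fun _ => aemeasurable_id')).indepFun hik
  have hpair : MeasurePreserving (fun x : Fin n → Patch d => (x i, x k))
      (Measure.pi fun _ : Fin n => isoGaussian d σξ)
      ((isoGaussian d σξ).prod (isoGaussian d σξ)) := by
    refine ⟨by fun_prop, ?_⟩
    rw [hind.map_prod_eq_prod_map_map (measurable_pi_apply i).aemeasurable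
        (measurable_pi_apply k).aemeasurable,
      (measurePreserving_eval (fun _ : Fin n => isoGaussian d σξ) i).map_eq,
      (measurePreserving_eval (fun _ : Fin n => isoGaussian d σξ) k).map_eq]
  exact hpair.comp measurePreserving_fst

lemma measurePreserving_init_noise (j : ℤˣ) (r : Fin m) (i : Fin n) :
    MeasurePreserving (fun ω : (Fin n → Patch d) × Weights m d => (ω.2 j r, ω.1 i))
      (noiseInitLaw n m d σξ σ0) ((isoGaussian d σ0).prod (isoGaussian d σξ)) :=
  Measure.measurePreserving_swap.comp
    ((measurePreserving_eval (fun _ : Fin n => isoGaussian d σξ) i).prod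
      (measurePreserving_weight (σ0 := σ0) j r))

/-- With high probability the patches are nearly orthogonal and the initialization is small. -/
lemma noiseInitLaw_not_good_le (hσξ : 0 < σξ) (hσ0 : 0 < σ0) (hn : 0 < n) {ε v : ℝ} (hε : 0 ≤ ε)
    (hε1 : ε ≤ 1) (hv : v = σξ ^ 2 * d) {μ : Patch d} {a a₁ a₂ : ℝ} (ha0 : 0 ≤ a)
    (hnorm : 16 * a ≤ ε ^ 2 * d) (hnn : 2 * (σξ ^ 2 * (2 * v)) * a ≤ (ε * v / n) ^ 2)
    (hns : 2 * (σξ ^ 2 * ‖μ‖ ^ 2) * a₁ ≤ (ε * v / n) ^ 2)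
    (hns' : 2 * (σξ ^ 2 * ‖μ‖ ^ 2) * a₁ ≤ (ε * ‖μ‖ ^ 2) ^ 2)
    (hin : 2 * (σ0 ^ 2 * (2 * v)) * a ≤ ε ^ 2) (his : 2 * (σ0 ^ 2 * ‖μ‖ ^ 2) * a₂ ≤ ε ^ 2) :
    noiseInitLaw n m d σξ σ0
        {ω | ¬ (NearlyOrthogonal ε v μ ω.1 ∧ SmallInit ε μ ω.1 ω.2)}
      ≤ ENNReal.ofReal (n * (2 * Real.exp (-a)) + (n * n * (2 * Real.exp (-a))
        + (n * (2 * Real.exp (-a₁)) + (n * (2 * Real.exp (-a₁))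
        + (2 * m * n * (2 * Real.exp (-a)) + 2 * m * (2 * Real.exp (-a₂))))))) := by
  set P := noiseInitLaw n m d σξ σ0
  have hn' : (0 : ℝ) < n := by exact_mod_cast hn
  have hv0 : 0 ≤ v := by rw [hv]; positivity
  have E1 : P {ω | ∃ i, ε * v < |‖ω.1 i‖ ^ 2 - v|}
      ≤ ENNReal.ofReal (n * (2 * Real.exp (-a))) := by
    have := measure_exists_le P (p := fun (i : Fin n) ω => ε * v < |‖ω.1 i‖ ^ 2 - v|)
      (b := 2 * Real.exp (-a)) fun i => by
        have hm : MeasurableSet {x : Patch d | ε * v < |‖x‖ ^ 2 - v|} :=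
          measurableSet_lt (by fun_prop) (by fun_prop)
        refine ((measurePreserving_noise i).measure_preimage hm.nullMeasurableSet).trans_le ?_
        rw [hv]
        refine (isoGaussian_abs_norm_sq_sub_gt_le hσξ hε hε1).trans (ENNReal.ofReal_le_ofReal ?_)
        gcongr
        linarith
    simpa using this
  have E2 : P {ω | ∃ p : Fin n × Fin n, p.1 ≠ p.2 ∧ ‖ω.1 p.2‖ ^ 2 ≤ 2 * v
      ∧ ε * v / n < |inner ℝ (ω.1 p.1) (ω.1 p.2)|}
      ≤ ENNReal.ofReal (n * n * (2 * Real.exp (-a))) := by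
    have := measure_exists_le P (p := fun (p : Fin n × Fin n) ω => p.1 ≠ p.2 ∧
      ‖ω.1 p.2‖ ^ 2 ≤ 2 * v ∧ ε * v / n < |inner ℝ (ω.1 p.1) (ω.1 p.2)|)
      (b := 2 * Real.exp (-a)) fun p => by
        by_cases hp : p.1 = p.2
        · simp [hp]
        · refine (measure_mono fun ω hω => hω.2).trans
            (measure_abs_inner_gt_le_of_indep hσξ (measurePreserving_noise_noise hp)
              (by positivity) ha0 hnn)
    simpa using this
  have E3 : ∀ t : ℝ, 0 ≤ t → 2 * (σξ ^ 2 * ‖μ‖ ^ 2) * a₁ ≤ t ^ 2 →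
      P {ω | ∃ i, t < |inner ℝ (ω.1 i) μ|} ≤ ENNReal.ofReal (n * (2 * Real.exp (-a₁))) := by
    intro t ht hta
    have := measure_exists_le P (p := fun (i : Fin n) ω => t < |inner ℝ (ω.1 i) μ|)
      (b := 2 * Real.exp (-a₁)) fun i => by
        have hm : MeasurableSet {x : Patch d | t < |inner ℝ x μ|} :=
          measurableSet_lt (by fun_prop) (by fun_prop)
        refine ((measurePreserving_noise i).measure_preimage hm.nullMeasurableSet).trans_le ?_
        exact isoGaussian_abs_inner_gt_le hσξ μ ht hta
    simpa using this
  have E4 : P {ω | ∃ p : ℤˣ × Fin m × Fin n, ‖ω.1 p.2.2‖ ^ 2 ≤ 2 * v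
      ∧ ε < |inner ℝ (ω.2 p.1 p.2.1) (ω.1 p.2.2)|}
      ≤ ENNReal.ofReal (2 * m * n * (2 * Real.exp (-a))) := by
    have := measure_exists_le P (p := fun (p : ℤˣ × Fin m × Fin n) ω =>
      ‖ω.1 p.2.2‖ ^ 2 ≤ 2 * v ∧ ε < |inner ℝ (ω.2 p.1 p.2.1) (ω.1 p.2.2)|)
      (b := 2 * Real.exp (-a)) fun p =>
        measure_abs_inner_gt_le_of_indep hσ0 (measurePreserving_init_noise p.1 p.2.1 p.2.2)
          hε ha0 hin
    simpa [mul_assoc] using this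
  have E5 : P {ω | ∃ p : ℤˣ × Fin m, ε < |inner ℝ (ω.2 p.1 p.2) μ|}
      ≤ ENNReal.ofReal (2 * m * (2 * Real.exp (-a₂))) := by
    have := measure_exists_le P (p := fun (p : ℤˣ × Fin m) ω => ε < |inner ℝ (ω.2 p.1 p.2) μ|)
      (b := 2 * Real.exp (-a₂)) fun p => by
        have hm : MeasurableSet {x : Patch d | ε < |inner ℝ x μ|} :=
          measurableSet_lt (by fun_prop) (by fun_prop)
        refine ((measurePreserving_init p.1 p.2).measure_preimage
          hm.nullMeasurableSet).trans_le ?_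
        exact isoGaussian_abs_inner_gt_le hσ0 μ hε his
    simpa using this
  refine (measure_mono ?_).trans (measure_or_le P (by positivity) (by positivity) E1
    (measure_or_le P (by positivity) (by positivity) E2
    (measure_or_le P (by positivity) (by positivity) (E3 (ε * v / n) (by positivity) hns)
    (measure_or_le P (by positivity) (by positivity) (E3 (ε * ‖μ‖ ^ 2) (by positivity) hns')
    (measure_or_le P (by positivity) (by positivity) E4 E5)))))
  intro ω hω
  by_contra hcon
  simp only [Set.mem_ofPred_eq, not_or, not_exists, not_and, not_lt, Prod.forall] at hcon
  obtain ⟨c1, c2, c3, c4, c5, c6⟩ := hcon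
  -- Off the first bad event the norm truncation built into the second and fifth ones is automatic.
  have hnorm2 : ∀ i, ‖ω.1 i‖ ^ 2 ≤ 2 * v := fun i => by
    have := (abs_le.1 (c1 i)).2
    nlinarith
  have hdiv : ∀ x : ℝ, x ≤ ε * v / n → n * x ≤ ε * v := fun x hx => by
    rwa [le_div_iff₀ hn', mul_comm] at hx
  exact hω ⟨⟨c1, fun i k hik => hdiv _ (c2 i k hik (hnorm2 k)), fun i => hdiv _ (c3 i), c4⟩,
    ⟨fun j r i => c5 j r i (hnorm2 i), c6⟩⟩

end GoodEvents

/-! ### Label counts -/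

section Labels

variable {n : ℕ} {τp τm : ℝ}

/-- With this, every function on the countable label space is measurable. -/
instance measurableSingletonClass_intUnits : MeasurableSingletonClass ℤˣ where
  measurableSet_singleton a :=
    ⟨{(a : ℤ)}, measurableSet_singleton _, by ext b; simp [Units.ext_iff]⟩

lemma BalancedLabels.labelMargin {y yObs : Fin n → ℤˣ} (h : BalancedLabels τp τm y yObs) {b : ℝ}
    (hb : ∀ a, b ≤ (1 - 2 * flipProb τp τm a) / 2) : LabelMargin b y yObs := by
  intro a
  have e : ∑ i with y i = a, sgn (y i) * sgn (yObs i)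
      = ((Finset.univ.filter fun i => y i = a ∧ yObs i = y i).card : ℝ)
        - (Finset.univ.filter fun i => y i = a ∧ yObs i ≠ y i).card := by
    rw [Finset.card_filter, Finset.card_filter, Finset.sum_filter]
    push_cast
    rw [← Finset.sum_sub_distrib]
    refine Finset.sum_congr rfl fun i _ => ?_
    rcases Int.units_eq_one_or (y i) with h1 | h1 <;>
      rcases Int.units_eq_one_or (yObs i) with h2 | h2 <;>
      rcases Int.units_eq_one_or a with h3 | h3 <;> simp [h1, h2, h3, sgn]
  rw [e, (h a).1, (h a).2]
  have := mul_le_mul_of_nonneg_right (hb a) (Nat.cast_nonneg (α := ℝ) n)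
  linarith

lemma flipProb_mem {lo hi : ℝ} (hp : τp ∈ Set.Icc lo hi) (hm : τm ∈ Set.Icc lo hi) (a : ℤˣ) :
    flipProb τp τm a ∈ Set.Icc lo hi := by
  unfold flipProb; split_ifs <;> assumption

lemma isProbabilityMeasure_labelLaw (hp : τp ∈ Set.Icc (0 : ℝ) 1) (hm : τm ∈ Set.Icc (0 : ℝ) 1) :
    IsProbabilityMeasure (labelLaw τp τm) := by
  have h := flipProb_mem hp hm
  have hun : (Finset.univ : Finset ℤˣ) = {1, -1} := rfl
  have h1 := h 1
  have h2 := h (-1)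
  constructor
  simp only [labelLaw, hun, Finset.sum_pair (show (1 : ℤˣ) ≠ -1 by decide), Measure.coe_add,
    Pi.add_apply, Measure.smul_apply, measure_univ, smul_eq_mul, mul_one]
  rw [← ENNReal.ofReal_add, ← ENNReal.ofReal_add, ← ENNReal.ofReal_add]
  · simp
    ring
  all_goals
    simp
    try linarith [h1.1, h1.2, h2.1, h2.2]

/-- The contribution of a labelled sample to the margin of class `a`. -/
noncomputable def classMargin (a : ℤˣ) (p : ℤˣ × ℤˣ) : ℝ :=
  if p.1 = a then sgn p.1 * sgn p.2 else 0

lemma classMargin_mem (a : ℤˣ) (p : ℤˣ × ℤˣ) : -classMargin a p ∈ Set.Icc (-1 : ℝ) 1 := by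
  rw [Set.mem_Icc, ← abs_le, abs_neg, classMargin]
  split_ifs
  · rw [abs_mul, abs_sgn, abs_sgn, one_mul]
  · simp

lemma integral_classMargin (hp : τp ∈ Set.Icc (0 : ℝ) 1) (hm : τm ∈ Set.Icc (0 : ℝ) 1) (a : ℤˣ) :
    ∫ p, -classMargin a p ∂labelLaw τp τm = -((1 - 2 * flipProb τp τm a) / 2) := by
  have h := flipProb_mem hp hm
  have hun : (Finset.univ : Finset ℤˣ) = {1, -1} := rfl
  have h1 := h 1
  have h2 := h (-1)
  have hint : ∀ (x : ENNReal), x ≠ ⊤ → ∀ q : ℤˣ × ℤˣ,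
      Integrable (fun p => -classMargin a p) (x • Measure.dirac q) := fun x hx q =>
    (integrable_dirac (by simp)).smul_measure hx
  have hint' : ∀ (y : ℤˣ), Integrable (fun p => -classMargin a p) (∑ y' : ℤˣ,
      ENNReal.ofReal (1 / 2 * (if y' = y then 1 - flipProb τp τm y else flipProb τp τm y)) •
        Measure.dirac (y, y')) := fun y =>
    integrable_finsetSum_measure.2 fun y' _ => hint _ ENNReal.ofReal_ne_top _
  rw [labelLaw, integral_finsetSum_measure fun y _ => hint' y]
  simp_rw [integral_finsetSum_measure fun y' _ => hint _ ENNReal.ofReal_ne_top _,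
    integral_smul_measure, integral_dirac]
  rw [hun, Finset.sum_pair (by decide), Finset.sum_pair (by decide), Finset.sum_pair (by decide)]
  have n1 : (1 : ℤˣ) ≠ -1 := by decide
  have n2 : (-1 : ℤˣ) ≠ 1 := by decide
  simp only [if_true, if_neg n1, if_neg n2]
  rw [ENNReal.toReal_ofReal (by linarith [h1.2]), ENNReal.toReal_ofReal (by linarith [h1.1]),
    ENNReal.toReal_ofReal (by linarith [h2.1]), ENNReal.toReal_ofReal (by linarith [h2.2])]
  rcases Int.units_eq_one_or a with rfl | rfl <;> simp [classMargin, n1, n2, sgn] <;> ring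

/-- Hoeffding's inequality for each class: the contributions lie in `[-1, 1]`, have mean `(1 - 2τ) /
2`, and their sum must fall short by `θ * n`. The factor `2` counts the classes. -/
lemma labelLaw_not_margin_le (hp : τp ∈ Set.Icc (0 : ℝ) 1) (hm : τm ∈ Set.Icc (0 : ℝ) 1)
    (hn : 0 < n) {b θ : ℝ} (hθ : 0 ≤ θ)
    (hb : ∀ a, b + θ ≤ (1 - 2 * flipProb τp τm a) / 2) :
    (Measure.pi fun _ : Fin n => labelLaw τp τm)
        {ω | ¬ LabelMargin b (fun i => (ω i).1) (fun i => (ω i).2)}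
      ≤ ENNReal.ofReal (2 * Real.exp (-(θ ^ 2 * n / 2))) := by
  have := isProbabilityMeasure_labelLaw hp hm
  set P := Measure.pi fun _ : Fin n => labelLaw τp τm
  have hn' : (0 : ℝ) < n := by exact_mod_cast hn
  have key : ∀ a : ℤˣ, P {ω | ∑ i with (ω i).1 = a, sgn (ω i).1 * sgn (ω i).2 < b * n}
      ≤ ENNReal.ofReal (Real.exp (-(θ ^ 2 * n / 2))) := by
    intro a
    have hmean := integral_classMargin hp hm a
    have hsub1 : HasSubgaussianMGF (fun p => -classMargin a p - ∫ p, -classMargin a p ∂labelLaw τp τm)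
        ((‖(1 : ℝ) - (-1)‖₊ / 2) ^ 2) (labelLaw τp τm) :=
      hasSubgaussianMGF_of_mem_Icc (measurable_of_countable _).aemeasurable
        (ae_of_all _ fun p => classMargin_mem a p)
    have hind := iIndepFun_pi (μ := fun _ : Fin n => labelLaw τp τm)
      (X := fun _ p => -classMargin a p - ∫ p, -classMargin a p ∂labelLaw τp τm)
      (fun _ => (measurable_of_countable _).aemeasurable)
    have hsub : ∀ i ∈ (Finset.univ : Finset (Fin n)), HasSubgaussianMGF
        (fun ω : Fin n → ℤˣ × ℤˣ =>
          -classMargin a (ω i) - ∫ p, -classMargin a p ∂labelLaw τp τm)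
        ((‖(1 : ℝ) - (-1)‖₊ / 2) ^ 2) P := fun i _ => by
      have e := (measurePreserving_eval (fun _ : Fin n => labelLaw τp τm) i).map_eq
      -- The mean is made opaque, so that rewriting `labelLaw` as a marginal of `P` leaves it alone.
      generalize (∫ p, -classMargin a p ∂labelLaw τp τm) = z at hsub1 ⊢
      rw [← e] at hsub1
      exact HasSubgaussianMGF.of_map (μ := P) (Y := Function.eval i)
        (X := fun p => -classMargin a p - z) (measurable_pi_apply i).aemeasurable hsub1
    have hoeff := HasSubgaussianMGF.measure_sum_ge_le_of_iIndepFun hind hsub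
      (mul_nonneg hθ hn'.le)
    have hc : ((‖(1 : ℝ) - (-1)‖₊ / 2) ^ 2 : NNReal) = 1 := by
      ext; push_cast; norm_num
    rw [hc] at hoeff
    rw [← ofReal_measureReal (measure_ne_top _ _)]
    refine ENNReal.ofReal_le_ofReal ((measureReal_mono fun ω hω => ?_).trans (hoeff.trans_eq ?_))
    · change ∑ i with (ω i).1 = a, sgn (ω i).1 * sgn (ω i).2 < b * n at hω
      change θ * n ≤ ∑ i, (-classMargin a (ω i) - ∫ p, -classMargin a p ∂labelLaw τp τm)
      have e : ∑ i, classMargin a (ω i) = ∑ i with (ω i).1 = a, sgn (ω i).1 * sgn (ω i).2 := by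
        rw [Finset.sum_filter]; rfl
      rw [hmean, Finset.sum_sub_distrib, Finset.sum_neg_distrib, e, Finset.sum_const,
        Finset.card_univ, Fintype.card_fin, nsmul_eq_mul]
      have := mul_le_mul_of_nonneg_right (hb a) hn'.le
      linarith
    · simp
      field_simp
  have h2 := measure_or_le P (Real.exp_pos _).le (Real.exp_pos _).le (key 1) (key (-1))
  rw [← two_mul] at h2
  refine (measure_mono fun ω hω => ?_).trans h2
  by_contra hcon
  simp only [Set.mem_ofPred_eq, not_or, not_lt] at hcon
  refine hω fun a => ?_
  rcases Int.units_eq_one_or a with rfl | rfl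
  · exact hcon.1
  · exact hcon.2

end Labels

/-! ### The parameter regime -/

/-- The exponential is `(δ / N) ^ 4`: two powers of `N` pay for the union bound, the other two give
the factor `1 / 100`. -/
lemma sq_mul_exp_neg_le {N δ : ℝ} (hN : 10 ≤ N) (hδ : 0 < δ) (hδ1 : δ < 1) :
    N ^ 2 * Real.exp (-(4 * Real.log (N / δ))) ≤ δ / 100 := by
  have hN0 : 0 < N := by linarith
  have e : Real.exp (-(4 * Real.log (N / δ))) = (δ / N) ^ 4 := by
    rw [← Real.exp_log (show 0 < (δ / N) ^ 4 by positivity), Real.log_pow, ← inv_div N δ,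
      Real.log_inv]
    congr 1
    push_cast
    ring
  have e2 : N ^ 2 * (δ / N) ^ 4 = δ ^ 4 / N ^ 2 := by field_simp
  rw [e, e2]
  have h1 : δ ^ 4 ≤ δ := pow_le_of_le_one hδ.le hδ1.le (by norm_num)
  have h2 : (100 : ℝ) ≤ N ^ 2 := by nlinarith
  exact div_le_div₀ hδ.le h1 (by norm_num) h2

lemma union_bound_le {n m δ : ℝ} (hn : 10 ≤ n) (hm : 10 ≤ m) (hδ : 0 < δ) (hδ1 : δ < 1) :
    n * (2 * Real.exp (-(4 * Real.log (n * m / δ))))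
      + (n * n * (2 * Real.exp (-(4 * Real.log (n * m / δ))))
      + (n * (2 * Real.exp (-(4 * Real.log (n / δ))))
      + (n * (2 * Real.exp (-(4 * Real.log (n / δ))))
      + (2 * m * n * (2 * Real.exp (-(4 * Real.log (n * m / δ))))
      + 2 * m * (2 * Real.exp (-(4 * Real.log (m / δ)))))))) ≤ δ / 2 := by
  have hnm : n ≤ n * m := le_mul_of_one_le_right (by linarith) (by linarith)
  have hnn : n ≤ n * n := le_mul_of_one_le_right (by linarith) (by linarith)
  have hmm : m ≤ m * m := le_mul_of_one_le_right (by linarith) (by linarith)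
  have b := sq_mul_exp_neg_le (hn.trans hnm) hδ hδ1
  have b1 := sq_mul_exp_neg_le hn hδ hδ1
  have b2 := sq_mul_exp_neg_le hm hδ hδ1
  have p := Real.exp_pos (-(4 * Real.log (n * m / δ)))
  have p1 := Real.exp_pos (-(4 * Real.log (n / δ)))
  have p2 := Real.exp_pos (-(4 * Real.log (m / δ)))
  have hsq : n * m ≤ (n * m) ^ 2 := by
    rw [sq]; exact le_mul_of_one_le_right (by linarith) (by linarith)
  have hnn2 : n * n ≤ (n * m) ^ 2 := by
    rw [sq]; exact mul_le_mul hnm hnm (by linarith) (by linarith)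
  have c1 := mul_le_mul_of_nonneg_right (hnm.trans hsq) p.le
  have c2 := mul_le_mul_of_nonneg_right hnn2 p.le
  have c3 := mul_le_mul_of_nonneg_right hsq p.le
  have c4 := mul_le_mul_of_nonneg_right hnn p1.le
  have c5 := mul_le_mul_of_nonneg_right hmm p2.le
  linarith

lemma snr_sq {d : ℕ} (μ : Patch d) (σξ : ℝ) : snr μ σξ ^ 2 = ‖μ‖ ^ 2 / (σξ ^ 2 * d) := by
  rw [snr, div_pow, mul_pow, Real.sq_sqrt (Nat.cast_nonneg _)]

namespace Regime

variable {C κlo κhi τlo τhi : ℝ} {n m d : ℕ} {μ : Patch d} {σξ σ0 η δ τp τm : ℝ}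

lemma two_le_div (R : Regime C κlo κhi τlo τhi n m d μ σξ σ0 η δ τp τm) : 2 ≤ (n : ℝ) / δ := by
  rw [le_div_iff₀ R.δ_pos]
  have : (2 : ℝ) ≤ n := by exact_mod_cast R.two_le_n
  linarith [R.δ_lt_one]

lemma half_lt_log (R : Regime C κlo κhi τlo τhi n m d μ σξ σ0 η δ τp τm) :
    1 / 2 < Real.log (n / δ) := by
  have h := Real.log_le_log (by norm_num) R.two_le_div
  have := Real.log_two_gt_d9
  linarith

/-- Sizes bootstrap each other: `n ≥ 2` bounds `log (n / δ)` below, which makes `m` large, which in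
turn makes `n` large. -/
lemma ten_le_m (R : Regime C κlo κhi τlo τhi n m d μ σξ σ0 η δ τp τm) (hC : 100 ≤ C) :
    (10 : ℝ) ≤ m := by
  have := R.m_large
  nlinarith [R.half_lt_log]

lemma half_lt_log' (R : Regime C κlo κhi τlo τhi n m d μ σξ σ0 η δ τp τm) (hC : 100 ≤ C) :
    1 / 2 < Real.log (m / δ) := by
  have h2 : 2 ≤ (m : ℝ) / δ := by
    rw [le_div_iff₀ R.δ_pos]
    linarith [R.δ_lt_one, R.ten_le_m hC]
  have h := Real.log_le_log (by norm_num) h2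
  have := Real.log_two_gt_d9
  linarith

lemma ten_le_n (R : Regime C κlo κhi τlo τhi n m d μ σξ σ0 η δ τp τm) (hC : 100 ≤ C) :
    (10 : ℝ) ≤ n := by
  have := R.n_large
  nlinarith [R.half_lt_log' hC]

lemma log_nonneg (R : Regime C κlo κhi τlo τhi n m d μ σξ σ0 η δ τp τm) (hC : 100 ≤ C) :
    0 ≤ Real.log (n * m / δ) := by
  refine Real.log_nonneg ?_
  rw [le_div_iff₀ R.δ_pos]
  nlinarith [R.δ_lt_one, R.ten_le_m hC, R.ten_le_n hC]

/-- For `d = 0` division by zero makes `snr` vanish, against `snr_lower`. -/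
lemma d_pos (R : Regime C κlo κhi τlo τhi n m d μ σξ σ0 η δ τp τm) (hκ : 0 < κlo) :
    (0 : ℝ) < d := by
  rcases Nat.eq_zero_or_pos d with rfl | h
  · have := R.snr_lower
    simp [snr] at this
    linarith
  · exact_mod_cast h

lemma le_signal (R : Regime C κlo κhi τlo τhi n m d μ σξ σ0 η δ τp τm) (hκ : 0 < κlo) :
    κlo * (σξ ^ 2 * d) ≤ n * ‖μ‖ ^ 2 := by
  have h := R.snr_lower
  have := R.d_pos hκ
  have := R.σξ_pos
  rwa [snr_sq, ← mul_div_assoc, le_div_iff₀ (by positivity)] at h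

lemma signal_le (R : Regime C κlo κhi τlo τhi n m d μ σξ σ0 η δ τp τm) (hκ : 0 < κlo) :
    n * ‖μ‖ ^ 2 ≤ κhi * (σξ ^ 2 * d) := by
  have h := R.snr_upper
  have := R.d_pos hκ
  have := R.σξ_pos
  rwa [snr_sq, ← mul_div_assoc, div_le_iff₀ (by positivity)] at h

lemma norm_pos (R : Regime C κlo κhi τlo τhi n m d μ σξ σ0 η δ τp τm) (hκ : 0 < κlo) :
    0 < ‖μ‖ := by
  have h := R.le_signal hκ
  have := R.d_pos hκ
  have := R.σξ_pos
  have h0 : 0 < κlo * (σξ ^ 2 * d) := by positivity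
  rcases (norm_nonneg μ).eq_or_lt with h1 | h1
  · rw [← h1] at h
    simp at h
    linarith
  · exact h1

/-- In the regime, the patches and the initialization are good with high probability. -/
lemma not_good_le (R : Regime C κlo κhi τlo τhi n m d μ σξ σ0 η δ τp τm) (hκ : 0 < κlo)
    {ε : ℝ} (hε : 0 < ε) (hε1 : ε ≤ 1) (hC : 100 ≤ C) (hCε : 64 ≤ C * ε ^ 2) :
    noiseInitLaw n m d σξ σ0
        {ω | ¬ (NearlyOrthogonal ε (σξ ^ 2 * d) μ ω.1 ∧ SmallInit ε μ ω.1 ω.2)}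
      ≤ ENNReal.ofReal (δ / 2) := by
  have hd := R.d_pos hκ
  have hσξ := R.σξ_pos
  have hσ0 := R.σ0_pos
  have hμ := R.norm_pos hκ
  have hn := R.ten_le_n hC
  have hm := R.ten_le_m hC
  have hL := R.log_nonneg hC
  have hL1 : 0 < Real.log (n / δ) := by linarith [R.half_lt_log]
  have hL2 : 0 < Real.log (m / δ) := by linarith [R.half_lt_log' hC]
  have hn0 : (0 : ℝ) < n := by linarith
  have hC0 : 0 < C := by linarith
  set L := Real.log (n * m / δ)
  set L1 := Real.log (n / δ)
  set L2 := Real.log (m / δ)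
  have hdL : C * (n ^ 2 * L) ≤ d :=
    (mul_le_mul_of_nonneg_left (le_max_left _ _) hC0.le).trans R.d_large
  have hdS : C * (n * ‖μ‖ * σξ⁻¹ * √L1) ≤ d :=
    (mul_le_mul_of_nonneg_left (le_max_right _ _) hC0.le).trans R.d_large
  have hσn : σ0 ≤ C⁻¹ * (√n * σξ⁻¹ * (d : ℝ)⁻¹) :=
    R.σ0_small.trans (mul_le_mul_of_nonneg_left (min_le_left _ _) (by positivity))
  have hσs : σ0 ≤ C⁻¹ * (‖μ‖⁻¹ * (√L2)⁻¹) :=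
    R.σ0_small.trans (mul_le_mul_of_nonneg_left (min_le_right _ _) (by positivity))
  have key : 64 * (n ^ 2 * L) ≤ ε ^ 2 * d := by
    have h1 := mul_le_mul_of_nonneg_right hCε (show 0 ≤ (n : ℝ) ^ 2 * L by positivity)
    have h2 := mul_le_mul_of_nonneg_left hdL (sq_nonneg ε)
    linarith
  have hn2 : L ≤ n ^ 2 * L := le_mul_of_one_le_left hL (by nlinarith)
  have hCC : 64 ≤ C ^ 2 * ε ^ 2 := by nlinarith [sq_nonneg ε]
  refine (noiseInitLaw_not_good_le hσξ hσ0 (by exact_mod_cast hn0) hε.le hε1 rfl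
    (a := 4 * L) (a₁ := 4 * L1) (a₂ := 4 * L2) (by positivity) ?_ ?_ ?_ ?_ ?_ ?_).trans
    (ENNReal.ofReal_le_ofReal ?_)
  -- The six tail conditions: norms and noise pairs use `d ≥ C n² L`; noise against signal uses the
  -- other bound on `d`, then `signal_large`; the initialization uses the two bounds on `σ0`.
  · linarith
  · rw [div_pow, le_div_iff₀ (by positivity)]
    have h0 : 0 ≤ σξ ^ 4 * d := by positivity
    have := mul_le_mul_of_nonneg_right key h0
    have h3 : 0 ≤ n ^ 2 * L * (σξ ^ 4 * d) := by positivity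
    linarith
  · rw [div_pow, le_div_iff₀ (by positivity)]
    have h1 : (C * (n * ‖μ‖ * σξ⁻¹ * √L1)) ^ 2 ≤ (d : ℝ) ^ 2 :=
      pow_le_pow_left₀ (by positivity) hdS 2
    have h2 : (C * (n * ‖μ‖ * σξ⁻¹ * √L1)) ^ 2 * σξ ^ 2 = C ^ 2 * (n ^ 2 * ‖μ‖ ^ 2 * L1) := by
      rw [mul_pow, mul_pow, Real.sq_sqrt hL1.le]
      field_simp
    have h3 := mul_le_mul_of_nonneg_right h1 (show 0 ≤ σξ ^ 4 * ε ^ 2 by positivity)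
    have h4 := mul_le_mul_of_nonneg_right hCC
      (show 0 ≤ n ^ 2 * ‖μ‖ ^ 2 * L1 * σξ ^ 2 by positivity)
    have h5 : (C * (n * ‖μ‖ * σξ⁻¹ * √L1)) ^ 2 * (σξ ^ 4 * ε ^ 2)
        = C ^ 2 * (n ^ 2 * ‖μ‖ ^ 2 * L1) * (σξ ^ 2 * ε ^ 2) := by rw [← h2]; ring
    have h6 : 0 ≤ n ^ 2 * ‖μ‖ ^ 2 * L1 * σξ ^ 2 := by positivity
    linarith
  · have h1 := mul_le_mul_of_nonneg_left R.signal_large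
      (show 0 ≤ ε ^ 2 * ‖μ‖ ^ 2 by positivity)
    have h2 := mul_le_mul_of_nonneg_right hCε (show 0 ≤ σξ ^ 2 * L1 * ‖μ‖ ^ 2 by positivity)
    have h3 : 0 ≤ σξ ^ 2 * L1 * ‖μ‖ ^ 2 := by positivity
    linarith
  · have h1 : σ0 ^ 2 ≤ (C⁻¹ * (√n * σξ⁻¹ * (d : ℝ)⁻¹)) ^ 2 := pow_le_pow_left₀ hσ0.le hσn 2
    have h2 : (C⁻¹ * (√n * σξ⁻¹ * (d : ℝ)⁻¹)) ^ 2 = n / (C ^ 2 * σξ ^ 2 * d ^ 2) := by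
      rw [mul_pow, mul_pow, mul_pow, Real.sq_sqrt hn0.le]
      field_simp
    rw [h2, le_div_iff₀ (by positivity)] at h1
    have h3 := mul_le_mul_of_nonneg_right h1 hL
    have h4 : n * L ≤ n ^ 2 * L := by
      refine mul_le_mul_of_nonneg_right ?_ hL
      nlinarith
    have h5 : 16 * (σ0 ^ 2 * σξ ^ 2 * d * L) * (C ^ 2 * d) ≤ ε ^ 2 * (C ^ 2 * d) := by
      have hC2 : 1 ≤ C ^ 2 := by nlinarith
      have h6 : ε ^ 2 * d ≤ ε ^ 2 * d * C ^ 2 := le_mul_of_one_le_right (by positivity) hC2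
      have h7 : 0 ≤ n ^ 2 * L := by positivity
      linarith
    have h6 := le_of_mul_le_mul_right h5 (by positivity)
    linarith
  · have h1 : σ0 ^ 2 ≤ (C⁻¹ * (‖μ‖⁻¹ * (√L2)⁻¹)) ^ 2 := pow_le_pow_left₀ hσ0.le hσs 2
    have h2 : (C⁻¹ * (‖μ‖⁻¹ * (√L2)⁻¹)) ^ 2 = 1 / (C ^ 2 * (‖μ‖ ^ 2 * L2)) := by
      rw [mul_pow, mul_pow, inv_pow (√L2), Real.sq_sqrt hL2.le]
      field_simp
    rw [h2, le_div_iff₀ (by positivity)] at h1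
    have h5 : 8 * (σ0 ^ 2 * ‖μ‖ ^ 2 * L2) * C ^ 2 ≤ ε ^ 2 * C ^ 2 := by linarith
    have h6 := le_of_mul_le_mul_right h5 (by positivity)
    linarith
  · exact union_bound_le hn hm R.δ_pos R.δ_lt_one

/-- In the regime, random labels have a margin with high probability. -/
lemma not_margin_le (R : Regime C κlo κhi τlo τhi n m d μ σξ σ0 η δ τp τm) (hτlo : 0 < τlo)
    (hτhi : τhi < 1 / 2) {θ : ℝ} (hθ : 0 ≤ θ) (hC : 100 ≤ C) (hCθ : 64 ≤ C * θ ^ 2) :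
    (Measure.pi fun _ : Fin n => labelLaw τp τm)
        {ω | ¬ LabelMargin ((1 - 2 * τhi) / 2 - θ) (fun i => (ω i).1) (fun i => (ω i).2)}
      ≤ ENNReal.ofReal (δ / 2) := by
  have hsub : Set.Icc τlo τhi ⊆ Set.Icc (0 : ℝ) 1 :=
    Set.Icc_subset_Icc hτlo.le (by linarith)
  have hn := R.ten_le_n hC
  have hm := R.ten_le_m hC
  have hL2 : 0 < Real.log (m / δ) := by linarith [R.half_lt_log' hC]
  have hnpos : 0 < n := by
    have : (0 : ℝ) < n := by linarith
    exact_mod_cast this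
  refine (labelLaw_not_margin_le (hsub R.τp_mem) (hsub R.τm_mem) hnpos hθ
    (fun a => by linarith [(flipProb_mem R.τp_mem R.τm_mem a).2])).trans
    (ENNReal.ofReal_le_ofReal ?_)
  have b2 := sq_mul_exp_neg_le hm R.δ_pos R.δ_lt_one
  have h1 : Real.exp (-(θ ^ 2 * n / 2)) ≤ Real.exp (-(4 * Real.log (m / δ))) := by
    rw [Real.exp_le_exp]
    have h2 := mul_le_mul_of_nonneg_left R.n_large (sq_nonneg θ)
    have h3 := mul_le_mul_of_nonneg_right hCθ hL2.le
    linarith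
  have c := mul_le_mul_of_nonneg_right (show (1 : ℝ) ≤ m ^ 2 by nlinarith)
    (Real.exp_pos (-(4 * Real.log (m / δ)))).le
  linarith [R.δ_pos]

end Regime

/-- On the good events, the first stage has the claimed outcome. -/
lemma Regime.outcome {C κlo κhi τlo τhi : ℝ} {n m d : ℕ} {μ : Patch d} {σξ σ0 η δ τp τm : ℝ}
    (R : Regime C κlo κhi τlo τhi n m d μ σξ σ0 η δ τp τm) (hC : 100 ≤ C) (hκ : 0 < κlo)
    {θ s₀ ε : ℝ} (hθ : 0 < θ) (hθ8 : θ ≤ 1 / 8) (hκhi : 0 ≤ κhi) (hs₀ : 4 * s₀ * (κhi + 4) = θ)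
    (hs₀pos : 0 < s₀) (hε : 16 * ε = s₀ * θ)
    (gap : 1 / 2 + 3 * θ ≤ κlo * (((1 - 2 * τhi) / 2 - θ) / 2 - θ)) {T : ℕ}
    (hT1 : s₀ * (η⁻¹ * n * m * (σξ ^ 2)⁻¹ * (d : ℝ)⁻¹) ≤ T)
    (hT2 : (T : ℝ) ≤ 2 * s₀ * (η⁻¹ * n * m * (σξ ^ 2)⁻¹ * (d : ℝ)⁻¹))
    {y yObs : Fin n → ℤˣ} {ξ : Fin n → Patch d} {W₀ : Weights m d}
    (hortho : NearlyOrthogonal ε (σξ ^ 2 * d) μ ξ) (hinit : SmallInit ε μ ξ W₀)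
    (hL : LabelMargin ((1 - 2 * τhi) / 2 - θ) y yObs) :
    StageOneOutcome (s₀ / 4) (2 * s₀ * (κhi + 2)) ⟨μ, y, yObs, ξ⟩ η W₀ T := by
  have hd := R.d_pos hκ
  have hσξ := R.σξ_pos
  have hη := R.η_pos
  have hμ := R.norm_pos hκ
  have hn : (0 : ℝ) < n := by linarith [R.ten_le_n hC]
  have hm : (0 : ℝ) < m := by linarith [R.ten_le_m hC]
  -- In the natural time unit, `T` steps amount to a rescaled time `s` between `s₀` and `2 * s₀`.
  have hunit : (η⁻¹ * n * m * (σξ ^ 2)⁻¹ * (d : ℝ)⁻¹) * (η / (n * m) * (σξ ^ 2 * d)) = 1 := by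
    field_simp
  have hstep : 0 ≤ η / (n * m) * (σξ ^ 2 * d) := by positivity
  have hs1 : s₀ ≤ T * (η / (n * m) * (σξ ^ 2 * d)) := by
    have := mul_le_mul_of_nonneg_right hT1 hstep
    rwa [mul_assoc, hunit, mul_one] at this
  have hs2 : T * (η / (n * m) * (σξ ^ 2 * d)) ≤ 2 * s₀ := by
    have := mul_le_mul_of_nonneg_right hT2 hstep
    rwa [mul_assoc (2 * s₀), hunit, mul_one] at this
  set s := T * (η / (n * m) * (σξ ^ 2 * d)) with hs
  have hsK := mul_le_mul_of_nonneg_right hs2 (show 0 ≤ κhi + 4 by linarith)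
  have hs₀1 : s₀ ≤ 1 := by nlinarith
  have hε0 : 0 ≤ ε := by nlinarith
  have hsθ : s₀ * θ ≤ θ := mul_le_of_le_one_left hθ.le hs₀1
  have hεθ : 16 * ε ≤ θ := by linarith
  have H : FirstStage ε (σξ ^ 2 * d) κhi s ⟨μ, y, yObs, ξ⟩ η W₀ T :=
    { n_pos := by exact_mod_cast hn
      m_pos := by exact_mod_cast hm
      η_nonneg := hη.le
      ε_nonneg := hε0
      ε_le := by linarith
      v_pos := by positivity
      signal_pos := by positivity
      ortho := hortho
      init := hinit
      signal_le := R.signal_le hκ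
      time_le := le_rfl
      small := by linarith }
  have hspos : 0 < s := hs₀pos.trans_le hs1
  -- The normalization of `s₀` gives `s * (κhi + 4) ≤ θ / 2`, that of `ε` gives `4 * ε ≤ θ / 4`; the
  -- third `θ` in `gap` absorbs the factor `1 + ε`.
  refine H.outcome hs hL hθ hθ8 ?_ ?_ (R.le_signal hκ) ?_ ?_ hspos ?_ ?_ ?_
  · linarith
  · have h1 : 16 * (ε * (κhi + 4)) * 4 = θ * θ := by
      linear_combination 4 * (κhi + 4) * hε + θ * hs₀
    nlinarith
  · by_contra hneg
    push Not at hneg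
    nlinarith
  · have : θ * ε ≤ 1 * ε := mul_le_mul_of_nonneg_right (by linarith) hε0
    linarith
  · have := mul_le_mul_of_nonneg_right hs1 hθ.le
    linarith
  · linarith
  · exact mul_le_mul_of_nonneg_right hs2 (by linarith)

/-- The end of the first stage, after about `s₀` units of time. -/
lemma Regime.exists_time {C κlo κhi τlo τhi : ℝ} {n m d : ℕ} {μ : Patch d}
    {σξ σ0 η δ τp τm : ℝ} (R : Regime C κlo κhi τlo τhi n m d μ σξ σ0 η δ τp τm) (hC : 100 ≤ C)
    (hκ : 0 < κlo) {s₀ : ℝ} (hs₀ : 0 < s₀) (hs₀C : 1 ≤ s₀ * C) :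
    ∃ T : ℕ, s₀ * (η⁻¹ * n * m * (σξ ^ 2)⁻¹ * (d : ℝ)⁻¹) ≤ T ∧
      (T : ℝ) ≤ 2 * s₀ * (η⁻¹ * n * m * (σξ ^ 2)⁻¹ * (d : ℝ)⁻¹) := by
  have hd := R.d_pos hκ
  have hσξ := R.σξ_pos
  have hη := R.η_pos
  have hm := R.ten_le_m hC
  have hC0 : 0 < C := by linarith
  have h1 : η ≤ C⁻¹ * ((σξ ^ 2)⁻¹ * (d : ℝ)⁻¹ * n) :=
    R.η_small.trans (mul_le_mul_of_nonneg_left (min_le_right _ _) (by positivity))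
  have h2 : C ≤ η⁻¹ * n * (σξ ^ 2)⁻¹ * (d : ℝ)⁻¹ := by
    have h3 := mul_le_mul_of_nonneg_left h1 (show 0 ≤ C * η⁻¹ by positivity)
    rw [mul_assoc C, inv_mul_cancel₀ hη.ne', mul_one] at h3
    refine h3.trans_eq ?_
    field_simp
  have hU : C ≤ η⁻¹ * n * m * (σξ ^ 2)⁻¹ * (d : ℝ)⁻¹ := by
    have h3 : C ≤ (η⁻¹ * n * (σξ ^ 2)⁻¹ * (d : ℝ)⁻¹) * m :=
      h2.trans (le_mul_of_one_le_right (hC0.le.trans h2) (by linarith))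
    linarith
  have hU1 : 1 ≤ s₀ * (η⁻¹ * n * m * (σξ ^ 2)⁻¹ * (d : ℝ)⁻¹) :=
    hs₀C.trans (mul_le_mul_of_nonneg_left hU hs₀.le)
  -- The small step size makes the target time at least `1`, so rounding up at most doubles it.
  refine ⟨⌈s₀ * (η⁻¹ * n * m * (σξ ^ 2)⁻¹ * (d : ℝ)⁻¹)⌉₊, Nat.le_ceil _, ?_⟩
  have := Nat.ceil_lt_add_one (hU1.trans' zero_le_one)
  linarith

end LabelNoiseCNN

/-! ### Choice of constants and the main theorem -/

open LabelNoiseCNN MeasureTheory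

theorem theorem4p1 (κlo κhi τlo τhi : ℝ) (hκ : κlo ≤ κhi) (hτlo : 0 < τlo) (hτ : τlo ≤ τhi)
    (hτhi : τhi < 1 / 2) (hκτ : 2 < κlo * (1 - 2 * τhi)) :
    ∃ C lo hi : ℝ, 0 < C ∧ 0 < lo ∧ 0 < hi ∧
      ∀ (n m d : ℕ) (μ : LabelNoiseCNN.Patch d) (σξ σ0 η δ τp τm : ℝ),
        LabelNoiseCNN.Regime C κlo κhi τlo τhi n m d μ σξ σ0 η δ τp τm →
        ∃ T₁ : ℕ,
          lo * (η⁻¹ * n * m * (σξ ^ 2)⁻¹ * (d : ℝ)⁻¹) ≤ T₁ ∧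
          (T₁ : ℝ) ≤ hi * (η⁻¹ * n * m * (σξ ^ 2)⁻¹ * (d : ℝ)⁻¹) ∧
          -- fixed balanced labels, random noise patches and initialization
          (∀ y yObs : Fin n → ℤˣ, LabelNoiseCNN.BalancedLabels τp τm y yObs →
            LabelNoiseCNN.noiseInitLaw n m d σξ σ0
              {ω | ¬ LabelNoiseCNN.StageOneOutcome lo hi ⟨μ, y, yObs, ω.1⟩ η ω.2 T₁}
              ≤ ENNReal.ofReal δ) ∧
          -- independent random labels
          ((MeasureTheory.Measure.pi fun _ : Fin n => LabelNoiseCNN.labelLaw τp τm).prod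
              (LabelNoiseCNN.noiseInitLaw n m d σξ σ0)
              {ω | ¬ LabelNoiseCNN.StageOneOutcome lo hi
                ⟨μ, fun i => (ω.1 i).1, fun i => (ω.1 i).2, ω.2.1⟩ η ω.2.2 T₁}
              ≤ ENNReal.ofReal δ) := by
  have hκ0 : 0 < κlo := by
    by_contra h
    push Not at h
    nlinarith
  have hκhi : 0 < κhi := hκ0.trans_le hκ
  obtain ⟨θ, hθ, hθ8, gap⟩ : ∃ θ : ℝ, 0 < θ ∧ θ ≤ 1 / 8 ∧
      1 / 2 + 3 * θ ≤ κlo * (((1 - 2 * τhi) / 2 - θ) / 2 - θ) := by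
    have hpos : 0 < κlo * (1 - 2 * τhi) - 2 := by linarith
    -- Multiplied by `4`, the gap inequality reads `2 + (12 + 6 * κlo) * θ ≤ κlo * (1 - 2 * τhi)`.
    refine ⟨min (1 / 8) ((κlo * (1 - 2 * τhi) - 2) / (12 + 6 * κlo)),
      lt_min (by norm_num) (by positivity), min_le_left _ _, ?_⟩
    have h := min_le_right (1 / 8) ((κlo * (1 - 2 * τhi) - 2) / (12 + 6 * κlo))
    rw [le_div_iff₀ (by positivity)] at h
    linarith
  obtain ⟨s₀, hs₀, hs₀θ⟩ : ∃ s₀ : ℝ, 0 < s₀ ∧ 4 * s₀ * (κhi + 4) = θ :=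
    ⟨θ / (4 * (κhi + 4)), by positivity, by field_simp⟩
  obtain ⟨ε, hε, hεs⟩ : ∃ ε : ℝ, 0 < ε ∧ 16 * ε = s₀ * θ :=
    ⟨s₀ * θ / 16, by positivity, by ring⟩
  have hs₀1 : s₀ ≤ 1 := by nlinarith
  have hεθ : ε ≤ θ := by nlinarith
  have hεs' : ε ≤ s₀ := by nlinarith
  have hCε : 64 / ε ^ 2 * ε ^ 2 = 64 := by field_simp
  have hC : 100 ≤ 64 / ε ^ 2 := by
    rw [le_div_iff₀ (by positivity)]
    nlinarith
  have hCpos : 0 < 64 / ε ^ 2 := by positivity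
  have hCθ : 64 ≤ 64 / ε ^ 2 * θ ^ 2 :=
    hCε.ge.trans (mul_le_mul_of_nonneg_left (pow_le_pow_left₀ hε.le hεθ 2) hCpos.le)
  have hs₀C : 1 ≤ s₀ * (64 / ε ^ 2) := by
    have h2 : ε ^ 2 ≤ s₀ := by nlinarith
    have := mul_le_mul_of_nonneg_left h2 hCpos.le
    linarith
  refine ⟨64 / ε ^ 2, s₀ / 4, 2 * s₀ * (κhi + 2), hCpos, by positivity, by positivity, ?_⟩
  intro n m d μ σξ σ0 η δ τp τm R
  obtain ⟨T, hT1, hT2⟩ := R.exists_time hC hκ0 hs₀ hs₀C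
  have hU : 0 ≤ η⁻¹ * n * m * (σξ ^ 2)⁻¹ * (d : ℝ)⁻¹ := by
    have := R.η_pos
    positivity
  have hgood := R.not_good_le hκ0 hε (by linarith) hC hCε.ge
  have hlab := R.not_margin_le hτlo hτhi hθ.le hC hCθ
  refine ⟨T, le_trans (by gcongr; linarith) hT1,
    hT2.trans (mul_le_mul_of_nonneg_right (by nlinarith) hU), ?_, ?_⟩
  · intro y yObs hbal
    refine (measure_mono fun ω hω => ?_).trans
      (hgood.trans (ENNReal.ofReal_le_ofReal (by linarith [R.δ_pos])))
    intro hG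
    refine hω (R.outcome hC hκ0 hθ hθ8 hκhi.le hs₀θ hs₀ hεs gap hT1 hT2 hG.1 hG.2 ?_)
    -- Balanced labels have the full margin; the loss `θ` is needed only for random ones.
    exact hbal.labelMargin fun a => by linarith [(flipProb_mem R.τp_mem R.τm_mem a).2]
  · have hsub : Set.Icc τlo τhi ⊆ Set.Icc (0 : ℝ) 1 :=
      Set.Icc_subset_Icc hτlo.le (by linarith)
    have := isProbabilityMeasure_labelLaw (hsub R.τp_mem) (hsub R.τm_mem)
    set A := {ω : Fin n → ℤˣ × ℤˣ | ¬ LabelMargin ((1 - 2 * τhi) / 2 - θ)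
      (fun i => (ω i).1) (fun i => (ω i).2)}
    set B := {ω : (Fin n → Patch d) × Weights m d |
      ¬ (NearlyOrthogonal ε (σξ ^ 2 * d) μ ω.1 ∧ SmallInit ε μ ω.1 ω.2)}
    -- Failure requires bad labels or bad patches and weights, each of probability at most `δ / 2`.
    have hsubset : {ω : (Fin n → ℤˣ × ℤˣ) × (Fin n → Patch d) × Weights m d |
        ¬ StageOneOutcome (s₀ / 4) (2 * s₀ * (κhi + 2))
          ⟨μ, fun i => (ω.1 i).1, fun i => (ω.1 i).2, ω.2.1⟩ η ω.2.2 T}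
        ⊆ A ×ˢ Set.univ ∪ Set.univ ×ˢ B := by
      intro ω hω
      by_contra hcon
      simp only [Set.mem_union, Set.mem_prod, Set.mem_univ, and_true, true_and, not_or] at hcon
      have hA := not_not.1 hcon.1
      have hB := not_not.1 hcon.2
      exact hω (R.outcome hC hκ0 hθ hθ8 hκhi.le hs₀θ hs₀ hεs gap hT1 hT2 hB.1 hB.2 hA)
    refine (measure_mono hsubset).trans ((measure_union_le _ _).trans ?_)
    rw [Measure.prod_prod, Measure.prod_prod, measure_univ, measure_univ, mul_one, one_mul]
    refine (add_le_add hlab hgood).trans_eq ?_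
    rw [← ENNReal.ofReal_add (by linarith [R.δ_pos]) (by linarith [R.δ_pos]), add_halves]
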